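/- Let $A\subset B$ be an irreducible subfactor of finite index, with $A,B$ von Neumann factors of type III. For unital $*$-homomorphisms $\varphi_1,\varphi_2:X\to Y$ put $\mathrm{Hom}(\varphi_1,\varphi_2)=\{t\in Y: t\varphi_1(x)=\varphi_2(x)t\ \forall x\in X\}$. A pair $r\in\mathrm{Hom}(\mathrm{id}_X,\bar\varphi\varphi)$, $\bar r\in\mathrm{Hom}(\mathrm{id}_Y,\varphi\bar\varphi)$ with $\varphi(r^*)\bar r=1$, $\bar\varphi(\bar r^*)r=1$, $r^*r=\delta\cdot 1$, $\bar r^*\bar r=\delta\cdot 1$ is a normalized solution of the conjugacy relations for $\varphi:X\to Y$, $\bar\varphi:Y\to X$; $\dim_\varphi$ is the infimum of $\delta$ over all such solutions, and a solution attaining it is called standard. Let $\iota:A\to B$ be the embedding, $\bar\iota:B\to A$ a conjugate homomorphism, and $(w,v)$ a standard solution for $\iota$, so that $w\in\mathrm{Hom}(\mathrm{id}_A,\theta)$, $v\in\mathrm{Hom}(\mathrm{id}_B,\gamma)$ with $\theta=\bar\iota\iota$, $\gamma=\iota\bar\iota$. Assume that $\gamma\simeq\bigoplus_a\gamma_a$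 is multiplicity-free, i.e. there are finitely many irreducible, pairwise inequivalent endomorphisms $\gamma_a$ of $B$ and isometries $s_a\in\mathrm{Hom}(\gamma_a,\gamma)$ with $\sum_a s_as_a^*=1$. Put $e_a=s_as_a^*$, $h_a=(\dim_\iota/\dim_{\gamma_a})^{1/2}s_a^*\iota(w)$ and $\phi_a(\cdot)=h_a^*\gamma_a(\cdot)h_a:B\to B$. Let $\chi:\mathrm{Hom}(\theta,\theta)\to\mathrm{Hom}(\gamma,\gamma)$, $\chi(t)=v^*\iota(t)\gamma(v)$, be the Fourier transform, with inverse $\chi^{-1}(s)=\theta(w^*)\bar\iota(s)w$, and define the convolution products $t_1\ast t_2=\chi^{-1}(\chi(t_1)\chi(t_2))$ and $s_1\ast s_2=\chi(\chi^{-1}(s_1)\chi^{-1}(s_2))$. Put $I_a=\chi^{-1}(e_a)$. Then the $I_a$ are pairwise distinct and are exactly the minimal projections of $[\mathrm{Hom}(\theta,\theta),\ast]$, with the involution also transported along $\chi$ (the irreducible boundary conditions); the families $(I_a)$ and $(\phi_a)$ are linearly independent, and $\dim_\iota$, $\dim_{\gamma_a}$ are positive. There are real numbers $C_{ab}^c\ge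 0$, the composition of boundary conditions, with $$I_aI_b=\sum_c C_{ab}^c\,I_c,\qquad\text{equivalently}\qquad e_a\ast e_b=\sum_c C_{ab}^c\,e_c .$$ The maps $\phi_a$ form a finite hypergroup $K_{A\subset B}$ under composition, $\phi_a\circ\phi_b=\sum_c\lambda_{ab}^c\,\phi_c$: the $\lambda_{ab}^c\geq0$ satisfy $\sum_c\lambda_{ab}^c=1$ and define an associative product, whose unit is a basis element $\phi_0=\mathrm{id}_B$, and there is an involution $a\mapsto\bar a$ of the index set with $\lambda_{\bar b\bar a}^{\bar c}=\lambda_{ab}^c$ and $\lambda_{ab}^0\ne0$ if and only if $b=\bar a$. Up to rescaling the two products coincide: $$\lambda_{ab}^c=\frac{\dim_\iota\,\dim_{\gamma_c}}{\dim_{\gamma_a}\dim_{\gamma_b}}\;C_{ab}^c ,$$ i.e. the elements $\frac{\dim_\iota}{\dim_{\gamma_a}}I_a$ under concatenation, and equally $\frac{\dim_\iota}{\dim_{\gamma_a}}e_a$ under convolution, multiply with the coefficients $\lambda_{ab}^c$. Moreover $\frac{\dim_\iota}{\dim_{\gamma_a}}I_a\mapsto\phi_a$ extends to an isomorphism of unital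 algebras from $\mathrm{Hom}(\theta,\theta)$ with the concatenation product onto the span of the maps $\phi_a$ with the composition product. -/

import Mathlib

noncomputable section

namespace Subfactor

/-! ### Homomorphisms, intertwiners, dimension -/

section General

variable {A B : Type*} [Ring A] [StarRing A] [Algebra ℂ A] [StarModule ℂ A]
  [Ring B] [StarRing B] [Algebra ℂ B] [StarModule ℂ B]

/-- `Hom(φ₁, φ₂) = {t ∈ B : t φ₁(a) = φ₂(a) t for all a ∈ A}`. -/
def Hom (φ₁ φ₂ : A →⋆ₐ[ℂ] B) : Submodule ℂ B where
  carrier := {t | ∀ a, t * φ₁ a = φ₂ a * t}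
  add_mem' := by
    intro s t hs ht a
    simp only [Set.mem_ofPred_eq] at hs ht
    rw [add_mul, mul_add, hs a, ht a]
  zero_mem' := by intro a; simp
  smul_mem' := by
    intro c t ht a
    simp only [Set.mem_ofPred_eq] at ht
    rw [smul_mul_assoc, mul_smul_comm, ht a]

/-- The algebra `Hom(φ, φ)` with the concatenation product, i.e. the product of `B`. -/
def EndAlg (φ : A →⋆ₐ[ℂ] B) : Subalgebra ℂ B where
  carrier := {t | t ∈ Hom φ φ}
  mul_mem' := by
    intro s t hs ht a
    have h₁ := hs a
    have h₂ := ht a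
    rw [mul_assoc, h₂, ← mul_assoc, h₁, mul_assoc]
  add_mem' := fun hs ht => (Hom φ φ).add_mem hs ht
  algebraMap_mem' := by
    intro c a
    exact Algebra.commutes c (φ a)

/-- `φ` is irreducible: `Hom(φ, φ) = ℂ 1`. -/
def IsIrred (φ : A →⋆ₐ[ℂ] B) : Prop :=
  ∀ t ∈ Hom φ φ, ∃ c : ℂ, t = c • (1 : B)

/-- Unitary equivalence of homomorphisms (equality of sectors). -/
def Equivalent (φ₁ φ₂ : A →⋆ₐ[ℂ] B) : Prop :=
  ∃ u : B, star u * u = 1 ∧ u * star u = 1 ∧ u ∈ Hom φ₁ φ₂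

/-- `(r, r')` solves the conjugacy relations for `φ : A → B` and `φ' : B → A`, with the
normalization `r* r = d 1_A`, `r'* r' = d 1_B`. With `t₂ × t₁ = t₂ φ₂(t₁)` the relation
`(1_φ × r*) ∘ (r' × 1_φ) = 1` reads `φ(r*) r' = 1`, and likewise for the other one. -/
structure IsConjSolution (φ : A →⋆ₐ[ℂ] B) (φ' : B →⋆ₐ[ℂ] A) (r : A) (r' : B) (d : ℝ) :
    Prop where
  mem_left : r ∈ Hom (StarAlgHom.id ℂ A) (φ'.comp φ)
  mem_right : r' ∈ Hom (StarAlgHom.id ℂ B) (φ.comp φ')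
  conj_left : φ (star r) * r' = 1
  conj_right : φ' (star r') * r = 1
  norm_left : star r * r = (d : ℂ) • (1 : A)
  norm_right : star r' * r' = (d : ℂ) • (1 : B)

/-- The dimension of `φ`: the infimum of `d` over all normalized solutions of the conjugacy
relations, over all conjugates of `φ`. -/
def dim (φ : A →⋆ₐ[ℂ] B) : ℝ :=
  sInf {d : ℝ | ∃ (φ' : B →⋆ₐ[ℂ] A) (r : A) (r' : B), IsConjSolution φ φ' r r' d}

/-- A standard solution of the conjugacy relations: one which attains the infimum. -/
def IsStandard (φ : A →⋆ₐ[ℂ] B) (φ' : B →⋆ₐ[ℂ] A) (r : A) (r' : B) : Prop :=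
  IsConjSolution φ φ' r r' (dim φ)

/-! ### Fourier transform and convolution

Here `ι : A → B`, `κ : B → A` is a conjugate of `ι`, `w ∈ Hom(id_A, κι)`, `v ∈ Hom(id_B, ικ)`. -/

/-- The canonical endomorphism `γ = ικ` of `B`. -/
def can (ι : A →⋆ₐ[ℂ] B) (κ : B →⋆ₐ[ℂ] A) : B →⋆ₐ[ℂ] B := ι.comp κ

/-- The dual canonical endomorphism `θ = κι` of `A`. -/
def dualCan (ι : A →⋆ₐ[ℂ] B) (κ : B →⋆ₐ[ℂ] A) : A →⋆ₐ[ℂ] A := κ.comp ι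

/-- The Fourier transform `χ : Hom(θ, θ) → Hom(γ, γ)`,
`χ(t) = (v* × 1_γ) ∘ (1_ι × t × 1_κ) ∘ (1_γ × v) = v* ι(t) γ(v)`. -/
def fourier (ι : A →⋆ₐ[ℂ] B) (κ : B →⋆ₐ[ℂ] A) (v : B) (t : A) : B :=
  star v * ι t * can ι κ v

/-- The inverse Fourier transform `χ⁻¹ : Hom(γ, γ) → Hom(θ, θ)`,
`χ⁻¹(s) = (1_θ × w*) ∘ (1_κ × s × 1_ι) ∘ (w × 1_θ) = θ(w*) κ(s) w`. -/
def fourierInv (ι : A →⋆ₐ[ℂ] B) (κ : B →⋆ₐ[ℂ] A) (w : A) (s : B) : A :=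
  dualCan ι κ (star w) * κ s * w

/-- The convolution product of `Hom(γ, γ)`: `s₁ ∗ s₂ = χ(χ⁻¹(s₁) ∘ χ⁻¹(s₂))`. -/
def conv (ι : A →⋆ₐ[ℂ] B) (κ : B →⋆ₐ[ℂ] A) (w : A) (v : B) (s₁ s₂ : B) : B :=
  fourier ι κ v (fourierInv ι κ w s₁ * fourierInv ι κ w s₂)

/-- The convolution product of `Hom(θ, θ)`: `t₁ ∗ t₂ = χ⁻¹(χ(t₁) ∘ χ(t₂))`. -/
def dualConv (ι : A →⋆ₐ[ℂ] B) (κ : B →⋆ₐ[ℂ] A) (w : A) (v : B) (t₁ t₂ : A) : A :=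
  fourierInv ι κ w (fourier ι κ v t₁ * fourier ι κ v t₂)

/-- The involution of the C*-algebra `[Hom(θ, θ), ∗]`, transported along `χ` in the same way
as its product. -/
def dualConvStar (ι : A →⋆ₐ[ℂ] B) (κ : B →⋆ₐ[ℂ] A) (w : A) (v : B) (t : A) : A :=
  fourierInv ι κ w (star (fourier ι κ v t))

/-- `t` is a projection of the algebra `[Hom(θ, θ), ∗]`. -/
def IsConvProjection (ι : A →⋆ₐ[ℂ] B) (κ : B →⋆ₐ[ℂ] A) (w : A) (v : B) (t : A) : Prop :=
  t ∈ Hom (dualCan ι κ) (dualCan ι κ) ∧ dualConv ι κ w v t t = t ∧ dualConvStar ι κ w v t = t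

/-- The irreducible boundary conditions between two copies of the extension `ι`: the minimal
projections of `[Hom(θ, θ), ∗]`. -/
def IsBoundaryCondition (ι : A →⋆ₐ[ℂ] B) (κ : B →⋆ₐ[ℂ] A) (w : A) (v : B) (t : A) : Prop :=
  IsConvProjection ι κ w v t ∧ t ≠ 0 ∧
    ∀ p : A, IsConvProjection ι κ w v p → dualConv ι κ w v p t = p → p = 0 ∨ p = t

/-! ### Multiplicity-free decomposition and the maps `φ_a` -/

/-- The family `(γ_a, s_a)` is a decomposition of the endomorphism `γ` of `B` into irreducible,
pairwise inequivalent endomorphisms: `s_a ∈ Hom(γ_a, γ)` are isometries with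
`∑ a, s_a s_a* = 1`. -/
structure IsMultFreeDecomp {α : Type*} [Fintype α] (γ : B →⋆ₐ[ℂ] B) (γs : α → B →⋆ₐ[ℂ] B)
    (s : α → B) : Prop where
  irred : ∀ a, IsIrred (γs a)
  inequiv : ∀ a b, a ≠ b → ¬ Equivalent (γs a) (γs b)
  mem : ∀ a, s a ∈ Hom (γs a) γ
  isometry : ∀ a, star (s a) * s a = 1
  sum_eq_one : ∑ a, s a * star (s a) = 1

/-- The projection `e = s s*`. -/
def proj (s : B) : B := s * star s

/-- `h_a = (dim_ι / dim_{γ_a})^{1/2} s_a* ι(w)`, for `γ_a = σ` and `s_a = s`. -/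
def hIso (ι : A →⋆ₐ[ℂ] B) (w : A) (σ : B →⋆ₐ[ℂ] B) (s : B) : B :=
  ((Real.sqrt (dim ι / dim σ) : ℝ) : ℂ) • (star s * ι w)

/-- `φ_a(m) = h_a* γ_a(m) h_a`, for `γ_a = σ` and `s_a = s`. -/
def phi (ι : A →⋆ₐ[ℂ] B) (w : A) (σ : B →⋆ₐ[ℂ] B) (s : B) : B →ₗ[ℂ] B where
  toFun m := star (hIso ι w σ s) * σ m * hIso ι w σ s
  map_add' := by intro x y; simp [mul_add, add_mul]
  map_smul' := by intro c x; simp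

end General

/-! ### Type III factors -/

section Factors

variable {H : Type*} [NormedAddCommGroup H] [InnerProductSpace ℂ H] [CompleteSpace H]

/-- A factor of type III: a nonzero von Neumann algebra with trivial centre in which every
nonzero projection `p` is infinite, i.e. equivalent to a proper subprojection of itself. -/
structure IsTypeIIIFactor (M : VonNeumannAlgebra H) : Prop where
  nontrivial : (1 : H →L[ℂ] H) ≠ 0
  factor : ∀ x ∈ M, x ∈ M.commutant → ∃ c : ℂ, x = c • (1 : H →L[ℂ] H)
  infinite : ∀ p ∈ M, IsStarProjection p → p ≠ 0 →
    ∃ u ∈ M, star u * u = p ∧ p * (u * star u) = u * star u ∧ u * star u ≠ p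

/-- The embedding homomorphism of a von Neumann algebra into a larger one. -/
def incl {N M : VonNeumannAlgebra H} (h : N ≤ M) :
    N.toStarSubalgebra →⋆ₐ[ℂ] M.toStarSubalgebra :=
  StarSubalgebra.inclusion (fun _ hx => h hx)

end Factors

/-! ### Hypergroups -/

/-- A finite hypergroup, given by its structure constants `k_a k_b = ∑ c, coeff a b c • k_c`
in the distinguished basis: an associative unital algebra with convex structure constants, whose
unit `k_one` is a basis element, and an involution `bar` of the basis, which extends to an
anti-automorphism, such that `coeff a b one ≠ 0` iff `b = bar a`. -/
structure FiniteHypergroup (α : Type*) [Fintype α] [DecidableEq α] where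
  coeff : α → α → α → ℝ
  one : α
  bar : α → α
  coeff_nonneg : ∀ a b c, 0 ≤ coeff a b c
  sum_coeff : ∀ a b, ∑ c, coeff a b c = 1
  assoc : ∀ a b c l,
    ∑ m, coeff a b m * coeff m c l = ∑ m, coeff b c m * coeff a m l
  one_mul : ∀ a b, coeff one a b = if b = a then 1 else 0
  mul_one : ∀ a b, coeff a one b = if b = a then 1 else 0
  bar_bar : ∀ a, bar (bar a) = a
  coeff_bar : ∀ a b c, coeff (bar b) (bar a) (bar c) = coeff a b c
  coeff_one_ne_zero_iff : ∀ a b, coeff a b one ≠ 0 ↔ b = bar a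

end Subfactor

end

noncomputable section

set_option linter.unusedSectionVars false

namespace Subfactor

/-! By multiplicity-freeness and Schur's lemma, Hom(γ, γ) is a commutative algebra with basis the
projections e_a (`exists_expand`). The Fourier transform is a linear bijection of Hom(θ, θ) onto it,
so the I_a form a basis of Hom(θ, θ), and every structure transported along χ is that of ℂ^α. The
numbers C are the coefficients of e_a ∗ e_b. They are nonnegative because `conv_eq` gives e_a ∗ e_b
= ι(w*) e_a γ(e_b) ι(w), which has the form y*y since e_a and γ(e_b) are commuting projections.

The link with the maps φ_a is `boundaryMap`, t ↦ v* ι(t κ(·) w). By the conjugacy relations it is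
multiplicative, unital and injective, and `phi_eq` shows that it sends (dim_ι / dim_{γ_a}) I_a to
φ_a. Composition of the φ_a therefore has the rescaled constants, and these sum to one because each
φ_a is unital.

The involution comes from the half-turn `rotation` of Hom(γ, γ), built from r = ι(w) v, which makes
γ self-conjugate. It permutes the e_a (`exists_bar`) and corresponds under χ to the adjoint on
Hom(θ, θ), so I_a* = I_{bar a}. Dimensions enter through `exists_bar_dim`: r restricts to a
normalized solution for γ_a whose constant is the trace r* e_a r, and an irreducible homomorphism
admits only one constant (`dim_unique`). The same trace computes the trivial coefficient of e_a ∗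
e_b. -/

/-- The consequences of positivity in a nonzero C*-algebra that are needed for intertwiners. -/
class PositiveStar (M : Type*) [Ring M] [StarRing M] [Algebra ℂ M] : Prop extends
    Nontrivial M where
  exists_nonneg : ∀ (x : M) (c : ℂ), star x * x = c • 1 → ∃ r : ℝ, 0 ≤ r ∧ c = r
  eq_zero : ∀ x : M, star x * x = 0 → x = 0

/-! ### Intertwiners, conjugates and uniqueness of the dimension. -/

section Intertwiners

variable {A B : Type*} [Ring A] [StarRing A] [Algebra ℂ A] [StarModule ℂ A]
  [Ring B] [StarRing B] [Algebra ℂ B] [StarModule ℂ B]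

theorem smul_one_inj [PositiveStar B] {c c' : ℂ} (h : c • (1 : B) = c' • (1 : B)) : c = c' :=
  smul_left_injective ℂ (one_ne_zero (α := B)) h

theorem star_mem_Hom {φ₁ φ₂ : A →⋆ₐ[ℂ] B} {t : B} (ht : t ∈ Hom φ₁ φ₂) :
    star t ∈ Hom φ₂ φ₁ := by
  intro a
  have h := congrArg star (ht (star a))
  simp only [star_mul, map_star, star_star] at h
  exact h.symm

theorem mul_mem_Hom {φ₁ φ₂ φ₃ : A →⋆ₐ[ℂ] B} {s t : B} (hs : s ∈ Hom φ₂ φ₃)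
    (ht : t ∈ Hom φ₁ φ₂) : s * t ∈ Hom φ₁ φ₃ := by
  intro a
  rw [mul_assoc, ht a, ← mul_assoc, hs a, mul_assoc]

theorem mem_Hom_comp {C : Type*} [Ring C] [StarRing C] [Algebra ℂ C] {φ₁ φ₂ : B →⋆ₐ[ℂ] C} {t : C}
    (ht : t ∈ Hom φ₁ φ₂) (ψ : A →⋆ₐ[ℂ] B) :
    t ∈ Hom (φ₁.comp ψ) (φ₂.comp ψ) :=
  fun a => ht (ψ a)

/-- Schur's lemma for inequivalent irreducible homomorphisms. -/
theorem eq_zero_of_not_equivalent [PositiveStar B] {φ₁ φ₂ : A →⋆ₐ[ℂ] B} (h₁ : IsIrred φ₁)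
    (h₂ : IsIrred φ₂) (hne : ¬ Equivalent φ₁ φ₂) {t : B} (ht : t ∈ Hom φ₁ φ₂) : t = 0 := by
  obtain ⟨c, hc⟩ := h₁ _ (mul_mem_Hom (star_mem_Hom ht) ht)
  obtain ⟨c', hc'⟩ := h₂ _ (mul_mem_Hom ht (star_mem_Hom ht))
  obtain ⟨r, hr, rfl⟩ := PositiveStar.exists_nonneg t c hc
  by_contra ht0
  have hr0 : r ≠ 0 := by
    rintro rfl
    exact ht0 (PositiveStar.eq_zero t (by simpa using hc))
  have hcc : c' = r := by
    have h : c' • t = (r : ℂ) • t := by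
      calc c' • t = (t * star t) * t := by rw [hc', smul_mul_assoc, one_mul]
        _ = t * (star t * t) := mul_assoc _ _ _
        _ = (r : ℂ) • t := by rw [hc, mul_smul_comm, mul_one]
    exact smul_left_injective ℂ ht0 h
  -- A nonzero t satisfies t*t = tt* = r with r > 0, so r^{-1/2} t is a unitary equivalence, which
  -- is excluded.
  have hsq : ((√r)⁻¹ : ℝ) * ((√r)⁻¹ : ℝ) * r = 1 := by
    have h1 := Real.mul_self_sqrt hr
    have h2 : √r ≠ 0 := fun h => hr0 (by rw [← h1, h, mul_zero])
    field_simp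
    rw [sq, h1]
  have hsq' : (((√r)⁻¹ : ℝ) : ℂ) * (((√r)⁻¹ : ℝ) : ℂ) * (r : ℂ) = 1 := by exact_mod_cast hsq
  refine hne ⟨(((√r)⁻¹ : ℝ) : ℂ) • t, ?_, ?_, (Hom φ₁ φ₂).smul_mem _ ht⟩
  · rw [star_smul, smul_mul_smul_comm, hc, smul_smul, Complex.star_def, Complex.conj_ofReal, hsq',
      one_smul]
  · rw [star_smul, smul_mul_smul_comm, hc', hcc, smul_smul, Complex.star_def, Complex.conj_ofReal,
      hsq', one_smul]

namespace IsConjSolution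

variable {φ : A →⋆ₐ[ℂ] B} {φ' : B →⋆ₐ[ℂ] A} {r : A} {r' : B} {d : ℝ}

theorem symm (h : IsConjSolution φ φ' r r' d) : IsConjSolution φ' φ r' r d :=
  ⟨h.mem_right, h.mem_left, h.conj_right, h.conj_left, h.norm_right, h.norm_left⟩

theorem comm (h : IsConjSolution φ φ' r r' d) (a : A) : r * a = φ' (φ a) * r := h.mem_left a

theorem comm_assoc (h : IsConjSolution φ φ' r r' d) (a x : A) :
    r * (a * x) = φ' (φ a) * (r * x) := by
  rw [← mul_assoc, h.comm, mul_assoc]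

theorem star_comm (h : IsConjSolution φ φ' r r' d) (a : A) :
    star r * φ' (φ a) = a * star r := star_mem_Hom h.mem_left a

theorem star_comm_assoc (h : IsConjSolution φ φ' r r' d) (a x : A) :
    star r * (φ' (φ a) * x) = a * (star r * x) := by
  rw [← mul_assoc, h.star_comm, mul_assoc]

theorem conj_star (h : IsConjSolution φ φ' r r' d) : star r' * φ r = 1 := by
  have := congrArg star h.conj_left
  simpa [← map_star] using this

theorem conj_star_assoc (h : IsConjSolution φ φ' r r' d) (x : B) : star r' * (φ r * x) = x := by
  rw [← mul_assoc, h.conj_star, one_mul]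

theorem left_ne_zero [Nontrivial B] (h : IsConjSolution φ φ' r r' d) : r ≠ 0 := by
  rintro rfl
  simpa using h.conj_left

theorem pos [PositiveStar A] [Nontrivial B] (h : IsConjSolution φ φ' r r' d) : 0 < d := by
  obtain ⟨c, hc, hcd⟩ := PositiveStar.exists_nonneg r d h.norm_left
  have hcd : d = c := by exact_mod_cast hcd
  rcases hc.lt_or_eq with h0 | h0
  · rwa [hcd]
  · refine absurd (PositiveStar.eq_zero r ?_) h.left_ne_zero
    rw [h.norm_left, hcd, ← h0]
    simp

/-- Frobenius reciprocity: a conjugate of an irreducible homomorphism is irreducible. -/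
theorem irred (h : IsConjSolution φ φ' r r' d) (hφ : IsIrred φ) : IsIrred φ' := by
  intro t ht
  -- Bending t with r and r' turns it into an element of Hom(φ, φ), hence a scalar; applying φ' and
  -- multiplying by r bends it back.
  obtain ⟨c, hc⟩ := hφ (star r' * φ (t * r)) (by
    intro x
    rw [map_mul, mul_assoc, mul_assoc, ← map_mul φ r x, h.comm, map_mul, ← mul_assoc (φ t),
      ← map_mul φ t, ht, map_mul, mul_assoc, h.symm.star_comm_assoc])
  have key : t * r = c • r := by
    have h1 := congrArg (fun x => φ' x * r) hc
    simp only [map_mul, mul_assoc, map_smul, map_one, smul_mul_assoc, one_mul] at h1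
    rw [← h.comm, ← h.comm_assoc, ← mul_assoc, h.conj_right, one_mul] at h1
    exact h1
  refine ⟨c, ?_⟩
  calc t = t * (φ' (star r') * r) := by rw [h.conj_right, mul_one]
    _ = φ' (star r') * (t * r) := by rw [← mul_assoc, ht, mul_assoc]
    _ = c • 1 := by rw [key, mul_smul_comm, h.conj_right]

/-- Normalized solutions for an irreducible homomorphism all have the same dimension. -/
theorem dim_unique [PositiveStar A] [PositiveStar B] (hφ : IsIrred φ)
    {φ₁ φ₂ : B →⋆ₐ[ℂ] A} {r₁ r₂ : A} {r₁' r₂' : B} {d₁ d₂ : ℝ}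
    (h₁ : IsConjSolution φ φ₁ r₁ r₁' d₁) (h₂ : IsConjSolution φ φ₂ r₂ r₂' d₂) : d₁ = d₂ := by
  -- This u carries one solution to the other. Since u*u and uu* are the same scalar x, comparing
  -- norms on the two sides gives d₂ = x d₁ and d₁ = x d₂, whence x = 1.
  have hu : φ₂ (star r₁') * r₂ ∈ Hom φ₁ φ₂ := by
    intro y
    rw [mul_assoc, h₂.comm, ← mul_assoc, ← map_mul, h₁.symm.star_comm, map_mul, mul_assoc]
  set u := φ₂ (star r₁') * r₂ with hudef
  have hur : u * r₁ = r₂ := by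
    rw [hudef, mul_assoc, h₂.comm, ← mul_assoc, ← map_mul, h₁.conj_star, map_one, one_mul]
  have hur' : star r₂' * φ u = star r₁' := by
    rw [hudef, map_mul, h₂.symm.star_comm_assoc, h₂.conj_star, mul_one]
  have hur'' : φ (star u) * r₂' = r₁' := by
    have := congrArg star hur'
    simpa [← map_star] using this
  obtain ⟨c, hc⟩ := h₁.irred hφ _ (mul_mem_Hom (star_mem_Hom hu) hu)
  obtain ⟨c', hc'⟩ := h₂.irred hφ _ (mul_mem_Hom hu (star_mem_Hom hu))
  obtain ⟨x, hx, rfl⟩ := PositiveStar.exists_nonneg u c hc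
  have hu0 : u ≠ 0 := by
    intro h
    apply h₂.left_ne_zero
    rw [← hur, h, zero_mul]
  have hcc : c' = x := by
    have h : c' • u = (x : ℂ) • u := by
      calc c' • u = (u * star u) * u := by rw [hc', smul_mul_assoc, one_mul]
        _ = u * (star u * u) := mul_assoc _ _ _
        _ = (x : ℂ) • u := by rw [hc, mul_smul_comm, mul_one]
    exact smul_left_injective ℂ hu0 h
  have e1 : (d₂ : ℂ) = x * d₁ := by
    apply smul_one_inj (B := A)
    rw [← h₂.norm_left, ← hur, star_mul, mul_assoc, ← mul_assoc (star u), hc, smul_mul_assoc,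
      one_mul, mul_smul_comm, h₁.norm_left, smul_smul]
  have e2 : (d₁ : ℂ) = x * d₂ := by
    apply smul_one_inj (B := B)
    rw [← h₁.norm_right]
    nth_rewrite 1 [← hur']
    rw [← hur'', mul_assoc, ← mul_assoc (φ u), ← map_mul, hc', hcc, map_smul, map_one,
      smul_mul_assoc, one_mul, mul_smul_comm, h₂.norm_right, smul_smul]
  have e1' : d₂ = x * d₁ := by exact_mod_cast e1
  have e2' : d₁ = x * d₂ := by exact_mod_cast e2
  have hd₁ := h₁.pos
  have hx1 : x * x = 1 := by
    have : (x * x - 1) * d₁ = 0 := by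
      rw [e1'] at e2'
      linarith
    rcases mul_eq_zero.1 this with h | h
    · linarith
    · exact absurd h hd₁.ne'
  have : x = 1 := by nlinarith
  rw [e1', this, one_mul]

theorem dim_eq [PositiveStar A] [PositiveStar B] (hφ : IsIrred φ)
    (h : IsConjSolution φ φ' r r' d) : dim φ = d := by
  have : {x : ℝ | ∃ (φ' : B →⋆ₐ[ℂ] A) (r : A) (r' : B), IsConjSolution φ φ' r r' x} = {d} := by
    ext x
    constructor
    · rintro ⟨ψ, q, q', hq⟩
      exact dim_unique hφ hq h
    · rintro rfl
      exact ⟨φ', r, r', h⟩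
  rw [dim, this, csInf_singleton]

/-- The composite solution for the canonical endomorphism. -/
theorem can_solution (h : IsConjSolution φ φ' r r' d) :
    IsConjSolution (can φ φ') (can φ φ') (φ r * r') (φ r * r') (d ^ 2) := by
  have hm : φ r * r' ∈ Hom (StarAlgHom.id ℂ B) ((can φ φ').comp (can φ φ')) := by
    intro b
    simp only [can, StarAlgHom.comp_apply, StarAlgHom.coe_id, id]
    rw [mul_assoc, h.symm.comm, ← mul_assoc, ← map_mul, h.comm, map_mul, mul_assoc]
  have hz : can φ φ' (star (φ r * r')) * (φ r * r') = 1 := by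
    have h1 : φ' (φ (star r)) * r = r * star r := (h.comm _).symm
    calc can φ φ' (star (φ r * r')) * (φ r * r')
        = φ (φ' (star r')) * (φ (φ' (φ (star r)) * r) * r') := by
          simp only [can, StarAlgHom.comp_apply, star_mul, map_mul, ← map_star, mul_assoc]
      _ = φ (φ' (star r') * r) * (φ (star r) * r') := by
          rw [h1, map_mul, map_mul, mul_assoc, mul_assoc]
      _ = 1 := by rw [h.conj_right, h.conj_left, map_one, one_mul]
  have hn : star (φ r * r') * (φ r * r') = ((d ^ 2 : ℝ) : ℂ) • (1 : B) := by
    rw [star_mul, mul_assoc, ← mul_assoc _ (φ r), ← map_star, ← map_mul, h.norm_left, map_smul,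
      map_one, smul_mul_assoc, one_mul, mul_smul_comm, h.norm_right, smul_smul]
    push_cast
    rw [sq]
  exact ⟨hm, hm, hz, hz, hn, hn⟩

end IsConjSolution

end Intertwiners

/-! ### The half-turn rotation for a self-conjugate endomorphism. -/

section Rotation

variable {B : Type*} [Ring B] [StarRing B] [Algebra ℂ B] [StarModule ℂ B]
  {γ : B →⋆ₐ[ℂ] B} {r : B} {D : ℝ}

/-- The rotation of `Hom(γ, γ)` by half a turn, for a self-conjugate endomorphism `γ`. -/
def rotation (γ : B →⋆ₐ[ℂ] B) (r : B) (t : B) : B := star r * γ t * γ r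

theorem rotation_mem (h : IsConjSolution γ γ r r D) {t : B} (ht : t ∈ Hom γ γ) :
    rotation γ r t ∈ Hom γ γ := by
  intro b
  rw [rotation, mul_assoc, mul_assoc, ← map_mul, ← map_mul, h.comm, ← mul_assoc t, ht,
    mul_assoc, map_mul, h.star_comm_assoc, map_mul, mul_assoc]

/-- Sliding an intertwiner around the cap r*: moving the outer r* inside γ produces γ(γ(r*) t r),
and t commutes past γ(r*) to leave γ(r*) r = 1. -/
theorem star_mul_rotation (h : IsConjSolution γ γ r r D) {t : B} (ht : t ∈ Hom γ γ) :
    star r * rotation γ r t = star r * γ t := by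
  rw [rotation, mul_assoc, ← h.star_comm_assoc, ← map_mul, ← map_mul, ← mul_assoc, ← ht,
    mul_assoc, h.conj_left, mul_one]

/-- Turning the plane by half a turn reverses the order of composition. -/
theorem rotation_mul (h : IsConjSolution γ γ r r D) {s t : B} (ht : t ∈ Hom γ γ) :
    rotation γ r s * rotation γ r t = rotation γ r (t * s) := by
  have hc : γ s * γ r * rotation γ r t = rotation γ r t * (γ s * γ r) := by
    rw [← map_mul, rotation_mem h ht]
  rw [rotation, mul_assoc (star r), mul_assoc (star r), hc, ← mul_assoc, star_mul_rotation h ht,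
    rotation, map_mul]
  simp only [mul_assoc]

/-- The adjoint rotation inverts the rotation. -/
theorem rotation_leftInv (h : IsConjSolution γ γ r r D) {t : B} (ht : t ∈ Hom γ γ) :
    star (rotation γ r (star (rotation γ r t))) = t := by
  have h1 : star (rotation γ r (star (rotation γ r t))) = γ (star r * rotation γ r t) * r := by
    rw [rotation]
    simp only [star_mul, map_star, map_mul, star_star, mul_assoc]
  rw [h1, star_mul_rotation h ht, map_mul, mul_assoc, ← h.comm, ← mul_assoc, h.conj_left, one_mul]

end Rotation

/-! ### Fourier transform, convolution and the representation on B. -/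

section Fourier

variable {A B : Type*} [Ring A] [StarRing A] [Algebra ℂ A] [StarModule ℂ A]
  [Ring B] [StarRing B] [Algebra ℂ B] [StarModule ℂ B]

theorem fourierInv_sum_smul (ι : A →⋆ₐ[ℂ] B) (κ : B →⋆ₐ[ℂ] A) (w : A) {α : Type*} [Fintype α]
    (c : α → ℂ) (x : α → B) :
    fourierInv ι κ w (∑ a, c a • x a) = ∑ a, c a • fourierInv ι κ w (x a) := by
  simp only [fourierInv, map_sum, map_smul, Finset.mul_sum, Finset.sum_mul, mul_smul_comm,
    smul_mul_assoc]

theorem fourier_sum_smul (ι : A →⋆ₐ[ℂ] B) (κ : B →⋆ₐ[ℂ] A) (v : B) {α : Type*} [Fintype α]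
    (c : α → ℂ) (x : α → A) :
    fourier ι κ v (∑ a, c a • x a) = ∑ a, c a • fourier ι κ v (x a) := by
  simp only [fourier, map_sum, map_smul, Finset.mul_sum, Finset.sum_mul, mul_smul_comm,
    smul_mul_assoc]

theorem fourierInv_smul (ι : A →⋆ₐ[ℂ] B) (κ : B →⋆ₐ[ℂ] A) (w : A) (c : ℂ) (x : B) :
    fourierInv ι κ w (c • x) = c • fourierInv ι κ w x := by
  simp only [fourierInv, map_smul, mul_smul_comm, smul_mul_assoc]

/-- This lets facts about χ⁻¹ be read off from facts about χ with the roles of ι and κ exchanged. -/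
theorem fourierInv_eq_star (ι : A →⋆ₐ[ℂ] B) (κ : B →⋆ₐ[ℂ] A) (w : A) (s : B) :
    fourierInv ι κ w s = star (fourier κ ι w (star s)) := by
  simp only [fourierInv, fourier, can, dualCan, StarAlgHom.comp_apply, star_mul, map_star,
    star_star, mul_assoc]

/-- The map `m ↦ v* ι(t κ(m) w)` on `B` associated with `t`. -/
def boundaryMap (ι : A →⋆ₐ[ℂ] B) (κ : B →⋆ₐ[ℂ] A) (w : A) (v : B) : A →ₗ[ℂ] Module.End ℂ B :=
  LinearMap.mk₂ ℂ (fun t m => star v * ι (t * κ m * w))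
    (by intro t t' m; simp only [add_mul, map_add, mul_add])
    (by intro c t m; simp only [smul_mul_assoc, map_smul, mul_smul_comm])
    (by intro t m m'; simp only [add_mul, map_add, mul_add])
    (by intro c t m; simp only [smul_mul_assoc, map_smul, mul_smul_comm])

theorem boundaryMap_apply (ι : A →⋆ₐ[ℂ] B) (κ : B →⋆ₐ[ℂ] A) (w : A) (v : B) (t : A) (m : B) :
    boundaryMap ι κ w v t m = star v * ι (t * κ m * w) := rfl

namespace IsConjSolution

variable {ι : A →⋆ₐ[ℂ] B} {κ : B →⋆ₐ[ℂ] A} {w : A} {v : B} {d : ℝ}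

theorem fourier_mem (h : IsConjSolution ι κ w v d) {t : A}
    (ht : t ∈ Hom (dualCan ι κ) (dualCan ι κ)) : fourier ι κ v t ∈ Hom (can ι κ) (can ι κ) := by
  intro b
  have ht' : t * κ (ι (κ b)) = κ (ι (κ b)) * t := ht (κ b)
  simp only [fourier, can, StarAlgHom.comp_apply]
  rw [mul_assoc, mul_assoc, ← map_mul ι (κ v), ← map_mul κ v, h.symm.comm, map_mul, map_mul,
    ← mul_assoc (ι t), ← map_mul ι t, ht', map_mul, mul_assoc, h.symm.star_comm_assoc, mul_assoc]

theorem fourierInv_mem (h : IsConjSolution ι κ w v d) {s : B}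
    (hs : s ∈ Hom (can ι κ) (can ι κ)) :
    fourierInv ι κ w s ∈ Hom (dualCan ι κ) (dualCan ι κ) := by
  rw [fourierInv_eq_star]
  exact star_mem_Hom (h.symm.fourier_mem (star_mem_Hom hs))

theorem fourierInv_fourier (h : IsConjSolution ι κ w v d) {t : A}
    (ht : t ∈ Hom (dualCan ι κ) (dualCan ι κ)) : fourierInv ι κ w (fourier ι κ v t) = t := by
  have ht' : t * κ (ι (star w)) = κ (ι (star w)) * t := ht (star w)
  simp only [fourierInv, fourier, can, dualCan, StarAlgHom.comp_apply, map_mul, mul_assoc]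
  rw [← h.comm, ← h.comm_assoc, ← mul_assoc (κ (star v)), h.conj_right, one_mul, ← mul_assoc,
    ← ht', mul_assoc, ← map_mul, h.conj_left, map_one, mul_one]

theorem star_mul_map_fourierInv (h : IsConjSolution ι κ w v d) (s : B) :
    star v * ι (κ (ι (star w)) * κ s) = ι (star w) * (s * star v) := by
  rw [← map_mul, h.symm.star_comm, mul_assoc]

theorem fourier_fourierInv (h : IsConjSolution ι κ w v d) {s : B}
    (hs : s ∈ Hom (can ι κ) (can ι κ)) : fourier ι κ v (fourierInv ι κ w s) = s := by
  have hs' : s * ι (κ v) = ι (κ v) * s := hs v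
  simp only [fourierInv, fourier, can, dualCan, StarAlgHom.comp_apply]
  rw [map_mul ι _ w, ← mul_assoc, h.star_mul_map_fourierInv, mul_assoc, mul_assoc, mul_assoc s,
    h.conj_star_assoc, hs', ← mul_assoc, ← map_mul, h.symm.conj_star, map_one, one_mul]

/-- The convolution product as a partial trace of the tensor product:
`s₁ ∗ s₂ = (1_ι × w* × 1_κ) ∘ (s₁ × s₂) ∘ (1_ι × w × 1_κ)`. -/
theorem conv_eq (h : IsConjSolution ι κ w v d) {s₁ s₂ : B}
    (hs₂ : s₂ ∈ Hom (can ι κ) (can ι κ)) :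
    conv ι κ w v s₁ s₂ = ι (star w) * (s₁ * (ι (κ s₂) * ι w)) := by
  have hu := fourier_fourierInv h hs₂
  have e1 : w * fourierInv ι κ w s₂ = κ (ι (fourierInv ι κ w s₂)) * w := h.comm _
  have e2 : star v * ι (κ (ι (fourierInv ι κ w s₂))) = ι (fourierInv ι κ w s₂) * star v :=
    h.symm.star_comm _
  have e3 : w * κ v = κ (ι (κ v)) * w := h.comm _
  have e4 : ι (fourierInv ι κ w s₂) = ι (κ (ι (star w))) * (ι (κ s₂) * ι w) := by
    simp only [fourierInv, dualCan, StarAlgHom.comp_apply, map_mul, mul_assoc]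
  have e5 : w * w = κ (ι w) * w := h.comm _
  have e6 : s₂ * ι (κ v) = ι (κ v) * s₂ := hs₂ v
  calc conv ι κ w v s₁ s₂
      = star v * ι (κ (ι (star w)) * κ s₁) *
          (ι (w * fourierInv ι κ w s₂) * ι (κ v)) := by
        simp only [conv, fourier, can, StarAlgHom.comp_apply, map_mul, mul_assoc]
        rw [fourierInv]
        simp only [dualCan, StarAlgHom.comp_apply, map_mul, mul_assoc]
    _ = ι (star w) * (s₁ * (ι (fourierInv ι κ w s₂) * ι (κ v))) := by
        rw [h.star_mul_map_fourierInv, e1, map_mul, mul_assoc, mul_assoc, ← mul_assoc (star v),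
          ← mul_assoc (star v), e2, mul_assoc (ι _) (star v), h.conj_star, mul_one]
    _ = ι (star w) * (s₁ * (ι (κ (ι (star w))) * (ι (κ s₂) * (ι (κ (ι (κ v))) * ι w)))) := by
        rw [e4, mul_assoc, mul_assoc, ← map_mul ι w, e3, map_mul]
    _ = ι (star w) * (s₁ * (ι (κ (ι (star w) * ι (κ v))) * (ι (κ s₂) * ι w))) := by
        rw [← mul_assoc (ι (κ s₂)), ← map_mul ι (κ s₂), ← map_mul κ s₂, e6]
        simp only [map_mul, mul_assoc]
    _ = ι (star w) * (s₁ * (ι (κ s₂) * ι w)) := by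
        rw [← map_mul, h.symm.conj_star, map_one, map_one, map_one, one_mul]

/-- Unfolded, χ applied to the adjoint of χ⁻¹(s) is literally the rotation of s* with r = ι(w) v.
This makes the adjoint permute the I_a. -/
theorem star_fourierInv (h : IsConjSolution ι κ w v d) {s : B}
    (hs : s ∈ Hom (can ι κ) (can ι κ)) :
    star (fourierInv ι κ w s) = fourierInv ι κ w (rotation (can ι κ) (ι w * v) (star s)) := by
  rw [← h.fourierInv_fourier (star_mem_Hom (h.fourierInv_mem hs))]
  congr 1
  simp only [fourierInv, fourier, rotation, can, dualCan, StarAlgHom.comp_apply, star_mul,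
    map_mul, map_star, star_star, mul_assoc]

/-- The left and the right partial traces on `Hom(γ, γ)` coincide. -/
theorem exists_trace [PositiveStar A] [PositiveStar B] (h : IsConjSolution ι κ w v d)
    (hι : IsIrred ι) {t : B}
    (ht : t ∈ Hom (can ι κ) (can ι κ)) :
    ∃ c : ℂ, ι (star w) * t * ι w = c • 1 ∧ star w * κ t * w = c • 1 := by
  obtain ⟨c, hc⟩ := hι (ι (star w) * t * ι w) (by
    intro a
    have h1 : t * ι (κ (ι a)) = ι (κ (ι a)) * t := ht (ι a)
    rw [mul_assoc, ← map_mul, h.comm, map_mul, mul_assoc, ← mul_assoc t, h1, mul_assoc,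
      ← mul_assoc, ← map_mul, h.star_comm, map_mul]
    simp only [mul_assoc])
  obtain ⟨c', hc'⟩ := h.irred hι (star w * κ t * w) (by
    intro b
    have h1 : κ t * κ (ι (κ b)) = κ (ι (κ b)) * κ t := by
      rw [← map_mul, ← map_mul]; exact congrArg κ (ht b)
    rw [mul_assoc, h.comm, mul_assoc, ← mul_assoc (κ t), h1, mul_assoc, h.star_comm_assoc]
    simp only [mul_assoc])
  -- Each one-sided trace is a scalar; closing up the remaining strand gives the same full trace in
  -- both cases, with the same factor d.
  have key : (c * d) • (1 : A) = (c' * d) • 1 := by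
    calc (c * d) • (1 : A) = star w * κ (ι (star w) * t * ι w) * w := by
          rw [hc, map_smul, map_one, mul_smul_comm, mul_one, smul_mul_assoc, h.norm_left, smul_smul]
      _ = star w * (star w * κ t * w) * w := by
          simp only [map_mul, mul_assoc]
          rw [← h.comm, h.star_comm_assoc]
      _ = (c' * d) • 1 := by
          rw [hc', mul_smul_comm, mul_one, smul_mul_assoc, h.norm_left, smul_smul]
  have hd : (d : ℂ) ≠ 0 := by exact_mod_cast h.pos.ne'
  refine ⟨c, hc, ?_⟩
  rw [hc', mul_right_cancel₀ hd (smul_one_inj key)]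

theorem boundaryMap_mul (h : IsConjSolution ι κ w v d) (t₁ t₂ : A) :
    boundaryMap ι κ w v (t₁ * t₂) = boundaryMap ι κ w v t₁ * boundaryMap ι κ w v t₂ := by
  ext m
  simp only [boundaryMap_apply, Module.End.mul_apply]
  rw [map_mul κ, mul_assoc t₁ (κ _ * κ _), mul_assoc (κ _) (κ _), ← h.comm,
    ← mul_assoc (κ (star v)), h.conj_right, one_mul]
  simp only [mul_assoc]

theorem boundaryMap_one (h : IsConjSolution ι κ w v d) : boundaryMap ι κ w v 1 = 1 := by
  ext m
  rw [boundaryMap_apply, one_mul, map_mul, ← mul_assoc, h.symm.star_comm, mul_assoc, h.conj_star,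
    mul_one, Module.End.one_apply]

/-- The value at v* is v* ι(t), and applying κ and multiplying by w recovers t. -/
theorem boundaryMap_injective (h : IsConjSolution ι κ w v d) :
    Function.Injective (boundaryMap ι κ w v) := by
  rw [injective_iff_map_eq_zero]
  intro t ht
  have h1 : star v * ι t = 0 := by
    have := LinearMap.congr_fun ht (star v)
    rwa [boundaryMap_apply, mul_assoc, h.conj_right, mul_one] at this
  have h2 : κ (star v) * (κ (ι t) * w) = 0 := by
    rw [← mul_assoc, ← map_mul, h1, map_zero, zero_mul]
  rwa [← h.comm, ← mul_assoc, h.conj_right, one_mul] at h2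

/-- With s = s_a s_a*, moving s_a* past γ(m) turns the right side into φ_a(m) up to the factor in
h_a. -/
theorem boundaryMap_fourierInv (h : IsConjSolution ι κ w v d) (s m : B) :
    boundaryMap ι κ w v (fourierInv ι κ w s) m = ι (star w) * s * ι (κ m) * ι w := by
  have e1 : star v * (ι w * ι w) = ι w := by
    rw [← map_mul, h.comm, map_mul, h.symm.star_comm_assoc, h.conj_star, mul_one]
  rw [boundaryMap_apply, fourierInv, mul_assoc, mul_assoc _ w, ← mul_assoc w, h.comm, map_mul,
    ← mul_assoc]
  simp only [dualCan, StarAlgHom.comp_apply]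
  rw [h.star_mul_map_fourierInv]
  simp only [map_mul, mul_assoc]
  rw [h.symm.star_comm_assoc, e1]

/-- Since d⁻¹ v v* is the projection onto the trivial component of γ, this is where the unit of the
hypergroup comes from. -/
theorem fourierInv_self (h : IsConjSolution ι κ w v d) :
    fourierInv ι κ w (v * star v) = 1 := by
  simp only [fourierInv, dualCan, StarAlgHom.comp_apply]
  rw [map_mul, mul_assoc, mul_assoc, h.conj_right, mul_one, ← map_mul, h.conj_left, map_one]

end IsConjSolution

end Fourier

/-! ### The algebra Hom(γ, γ) of a multiplicity-free endomorphism. -/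

namespace IsMultFreeDecomp

variable {B : Type*} [Ring B] [StarRing B] [Algebra ℂ B] [StarModule ℂ B] [PositiveStar B]
  {α : Type*} [Fintype α] {γ : B →⋆ₐ[ℂ] B} {γs : α → B →⋆ₐ[ℂ] B} {s : α → B}

theorem proj_mem (h : IsMultFreeDecomp γ γs s) (a : α) : proj (s a) ∈ Hom γ γ :=
  mul_mem_Hom (h.mem a) (star_mem_Hom (h.mem a))

theorem star_proj (s : B) : star (proj s) = proj s := by
  rw [proj, star_mul, star_star]

theorem star_mul_of_ne (h : IsMultFreeDecomp γ γs s) {a b : α} (hab : a ≠ b) :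
    star (s a) * s b = 0 :=
  eq_zero_of_not_equivalent (h.irred b) (h.irred a) (h.inequiv b a hab.symm)
    (mul_mem_Hom (star_mem_Hom (h.mem a)) (h.mem b))

theorem proj_mul_proj (h : IsMultFreeDecomp γ γs s) [DecidableEq α] (a b : α) :
    proj (s a) * proj (s b) = if b = a then proj (s a) else 0 := by
  rw [proj, proj, mul_assoc, ← mul_assoc (star (s a))]
  split_ifs with hab
  · rw [hab, h.isometry, one_mul]
  · rw [h.star_mul_of_ne (Ne.symm hab), zero_mul, mul_zero]

theorem proj_mul_self (h : IsMultFreeDecomp γ γs s) (a : α) :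
    proj (s a) * proj (s a) = proj (s a) := by
  classical
  rw [h.proj_mul_proj, if_pos rfl]

theorem proj_mul_left (h : IsMultFreeDecomp γ γs s) (a : α) : proj (s a) * s a = s a := by
  rw [proj, mul_assoc, h.isometry, mul_one]

theorem proj_ne_zero (h : IsMultFreeDecomp γ γs s) (a : α) : proj (s a) ≠ 0 := by
  intro h0
  have h1 := h.isometry a
  rw [← h.proj_mul_left a, h0, zero_mul, mul_zero] at h1
  exact zero_ne_one h1

/-- Reads off a single coefficient, giving both linear independence and positivity of coefficients.
-/
theorem compress (h : IsMultFreeDecomp γ γs s) (c : α → ℂ) (a : α) :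
    star (s a) * (∑ b, c b • proj (s b)) * s a = c a • 1 := by
  classical
  rw [Finset.mul_sum, Finset.sum_mul, Finset.sum_eq_single a]
  · rw [mul_smul_comm, smul_mul_assoc, mul_assoc, h.proj_mul_left, h.isometry]
  · intro b _ hb
    rw [proj, mul_smul_comm, ← mul_assoc, h.star_mul_of_ne hb.symm, zero_mul, smul_zero, zero_mul]
  · simp

theorem proj_mul_sum (h : IsMultFreeDecomp γ γs s) (c : α → ℂ) (a : α) :
    proj (s a) * (∑ b, c b • proj (s b)) = c a • proj (s a) := by
  classical
  simp only [Finset.mul_sum, mul_smul_comm, h.proj_mul_proj, smul_ite, smul_zero]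
  simp

theorem sum_mul_proj (h : IsMultFreeDecomp γ γs s) (c : α → ℂ) (a : α) :
    (∑ b, c b • proj (s b)) * proj (s a) = c a • proj (s a) := by
  classical
  simp only [Finset.sum_mul, smul_mul_assoc, h.proj_mul_proj, smul_ite, smul_zero]
  simp

theorem linearIndependent (h : IsMultFreeDecomp γ γs s) :
    LinearIndependent ℂ (fun a => proj (s a)) := by
  rw [Fintype.linearIndependent_iff]
  intro c hc a
  have h1 := h.compress c a
  rw [hc, mul_zero, zero_mul, ← zero_smul ℂ] at h1
  exact (smul_one_inj h1).symm

/-- The projections `s_a s_a*` span `Hom(γ, γ)`. -/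
theorem exists_expand (h : IsMultFreeDecomp γ γs s) {t : B} (ht : t ∈ Hom γ γ) :
    ∃ c : α → ℂ, t = ∑ a, c a • proj (s a) := by
  classical
  have h1 : ∀ a, ∃ c : ℂ, star (s a) * t * s a = c • 1 := fun a =>
    h.irred a _ (mul_mem_Hom (mul_mem_Hom (star_mem_Hom (h.mem a)) ht) (h.mem a))
  choose c hc using h1
  refine ⟨c, ?_⟩
  calc t = (∑ a, s a * star (s a)) * t * (∑ b, s b * star (s b)) := by
        rw [h.sum_eq_one, one_mul, mul_one]
    _ = ∑ a, ∑ b, s a * (star (s a) * t * s b) * star (s b) := by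
        simp only [Finset.sum_mul, Finset.mul_sum, mul_assoc]
        exact Finset.sum_comm
    _ = ∑ a, c a • proj (s a) := by
        refine Finset.sum_congr rfl fun a _ => ?_
        rw [Finset.sum_eq_single a]
        · rw [hc, mul_smul_comm, mul_one, smul_mul_assoc, proj]
        · intro b _ hb
          have h0 : star (s a) * t * s b = 0 :=
            eq_zero_of_not_equivalent (h.irred b) (h.irred a) (h.inequiv b a hb)
              (mul_mem_Hom (mul_mem_Hom (star_mem_Hom (h.mem a)) ht) (h.mem b))
          rw [h0, mul_zero, zero_mul]
        · simp

/-- Positive elements of `Hom(γ, γ)` have nonnegative coefficients. -/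
theorem exists_expand_nonneg (h : IsMultFreeDecomp γ γs s) {t y : B} (ht : t ∈ Hom γ γ)
    (hy : t = star y * y) :
    ∃ c : α → ℝ, (∀ a, 0 ≤ c a) ∧ t = ∑ a, (c a : ℂ) • proj (s a) := by
  obtain ⟨c, hc⟩ := h.exists_expand ht
  have h1 : ∀ a, ∃ r : ℝ, 0 ≤ r ∧ c a = r := by
    intro a
    apply PositiveStar.exists_nonneg (y * s a)
    rw [← h.compress c a, ← hc, hy, star_mul]
    simp only [mul_assoc]
  choose r hr hcr using h1
  exact ⟨r, hr, by rw [hc]; simp only [hcr]⟩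

/-- The idempotents of `Hom(γ, γ)` have coefficients `0` and `1`. -/
theorem coeff_of_idempotent (h : IsMultFreeDecomp γ γs s) {c : α → ℂ}
    (hi : (∑ a, c a • proj (s a)) * (∑ a, c a • proj (s a)) = ∑ a, c a • proj (s a)) (a : α) :
    c a = 0 ∨ c a = 1 := by
  have h1 : (c a * c a) • proj (s a) = c a • proj (s a) := by
    calc (c a * c a) • proj (s a)
        = proj (s a) * ((∑ a, c a • proj (s a)) * (∑ a, c a • proj (s a))) := by
          rw [← mul_assoc, h.proj_mul_sum, smul_mul_assoc, h.proj_mul_sum, smul_smul]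
      _ = _ := by rw [hi, h.proj_mul_sum]
  have h2 := smul_left_injective ℂ (h.proj_ne_zero a) h1
  rcases eq_or_ne (c a) 0 with h0 | h0
  · exact Or.inl h0
  · exact Or.inr (mul_left_cancel₀ h0 (by rw [h2, mul_one]))

/-- The rotation permutes the minimal projections of `Hom(γ, γ)` by an involution. -/
theorem exists_bar (h : IsMultFreeDecomp γ γs s) {r : B} {D : ℝ}
    (hr : IsConjSolution γ γ r r D) :
    ∃ bar : α → α, (∀ a, bar (bar a) = a) ∧
      ∀ a, rotation γ r (proj (s a)) = proj (s (bar a)) := by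
  classical
  choose c hc using fun a => h.exists_expand (rotation_mem hr (h.proj_mem a))
  -- The rotation is injective on Hom(γ, γ), so no projection is sent to zero.
  have hne : ∀ a, ∃ b, c a b ≠ 0 := by
    intro a
    by_contra! h0
    have h1 : rotation γ r (proj (s a)) = 0 := by rw [hc]; simp [h0]
    have h2 := rotation_leftInv hr (h.proj_mem a)
    rw [h1] at h2
    apply h.proj_ne_zero a
    rw [← h2]
    simp [rotation]
  choose f hf using hne
  -- Antimultiplicativity makes rotations of orthogonal projections orthogonal, so their supports
  -- are disjoint. With finitely many indices, disjoint nonempty supports must be singletons.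
  have hdisj : ∀ a a' b, c a b ≠ 0 → c a' b ≠ 0 → a = a' := by
    intro a a' b h1 h2
    by_contra hne
    have h3 := rotation_mul hr (s := proj (s a)) (h.proj_mem a')
    rw [h.proj_mul_proj, if_neg hne, hc a, hc a'] at h3
    have h4 : (c a b * c a' b) • proj (s b) = 0 := by
      rw [← smul_smul, ← h.proj_mul_sum, ← smul_mul_assoc, ← h.proj_mul_sum, mul_assoc, h3]
      simp [rotation]
    rcases smul_eq_zero.1 h4 with h5 | h5
    · exact mul_ne_zero h1 h2 h5
    · exact h.proj_ne_zero b h5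
  have hinj : Function.Injective f := by
    intro a a' haa
    exact hdisj a a' (f a) (hf a) (by rw [haa]; exact hf a')
  have hsurj := Finite.surjective_of_injective hinj
  have hrot : ∀ a, rotation γ r (proj (s a)) = proj (s (f a)) := by
    intro a
    have h1 : c a (f a) = 1 := by
      refine (h.coeff_of_idempotent ?_ (f a)).resolve_left (hf a)
      rw [← hc, rotation_mul hr (h.proj_mem a), h.proj_mul_self]
    rw [hc, Finset.sum_eq_single (f a), h1, one_smul]
    · intro b _ hb
      have : c a b = 0 := by
        by_contra h0
        obtain ⟨a', rfl⟩ := hsurj b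
        exact hb (by rw [hdisj a a' _ h0 (hf a')])
      rw [this, zero_smul]
    · simp
  refine ⟨f, fun a => ?_, hrot⟩
  have h1 := rotation_leftInv hr (h.proj_mem a)
  rw [hrot, star_proj, hrot, star_proj] at h1
  by_contra hne
  have h2 := h.proj_mul_self a
  nth_rewrite 1 [← h1] at h2
  rw [h.proj_mul_proj, if_neg (Ne.symm hne)] at h2
  exact h.proj_ne_zero a h2.symm

/-- A solution for `γ` restricts to solutions for its irreducible components. -/
theorem component_solution (h : IsMultFreeDecomp γ γs s) {r : B} {D : ℝ}
    (hr : IsConjSolution γ γ r r D) {a b : α} {τ : ℝ}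
    (hab : rotation γ r (proj (s a)) = proj (s b)) (hba : rotation γ r (proj (s b)) = proj (s a))
    (ha : star r * proj (s a) * r = (τ : ℂ) • 1) (hb : star r * proj (s b) * r = (τ : ℂ) • 1) :
    IsConjSolution (γs a) (γs b) (star (s b) * γ (star (s a)) * r)
      (star (s a) * γ (star (s b)) * r) τ := by
  have hmem : ∀ a b, star (s b) * γ (star (s a)) * r ∈
      Hom (StarAlgHom.id ℂ B) ((γs b).comp (γs a)) := by
    intro a b x
    have h1 : star (s a) * γ x = γs a x * star (s a) := star_mem_Hom (h.mem a) x
    have h2 : star (s b) * γ (γs a x) = γs b (γs a x) * star (s b) := star_mem_Hom (h.mem b) _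
    simp only [StarAlgHom.coe_id, id, StarAlgHom.comp_apply]
    rw [mul_assoc, hr.comm, ← mul_assoc, mul_assoc (star (s b)), ← map_mul, h1, map_mul,
      ← mul_assoc, h2]
    simp only [mul_assoc]
  -- Against r*, the projection e_a on one factor is the same as e_b on the other, so cutting r by
  -- both costs no more than cutting by one.
  have hslide : ∀ a b, rotation γ r (proj (s a)) = proj (s b) →
      star r * γ (proj (s a)) = star r * proj (s b) := by
    intro a b hab
    rw [← hab, star_mul_rotation hr (h.proj_mem a)]
  have hconj : ∀ a b, rotation γ r (proj (s a)) = proj (s b) →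
      γs a (star (star (s b) * γ (star (s a)) * r)) * (star (s a) * γ (star (s b)) * r) = 1 := by
    intro a b hab
    have h1 : ∀ x, γs a x * star (s a) = star (s a) * γ x :=
      fun x => (star_mem_Hom (h.mem a) x).symm
    have h2 : star r * (γ (s a) * (s b * star (s b))) = star r * γ (s a) := by
      have h3 : proj (s b) * γ (s a) = γ (s a) * proj (s b) := h.proj_mem b (s a)
      change star r * (γ (s a) * proj (s b)) = _
      rw [← h3, ← mul_assoc, ← hslide a b hab, mul_assoc, ← map_mul, h.proj_mul_left]
    calc γs a (star (star (s b) * γ (star (s a)) * r)) * (star (s a) * γ (star (s b)) * r)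
        = γs a (star r * (γ (s a) * s b)) * star (s a) * (γ (star (s b)) * r) := by
          simp only [star_mul, map_star, star_star, mul_assoc]
      _ = star (s a) * (γ (star r * (γ (s a) * (s b * star (s b)))) * r) := by
          rw [h1]
          simp only [map_mul, mul_assoc]
      _ = 1 := by
          rw [h2, map_mul, mul_assoc, ← hr.comm, ← mul_assoc (γ _), hr.conj_left, one_mul,
            h.isometry]
  have hnorm : ∀ a b, rotation γ r (proj (s a)) = proj (s b) →
      star (star (s b) * γ (star (s a)) * r) * (star (s b) * γ (star (s a)) * r) =
        star r * proj (s b) * r := by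
    intro a b hab
    have h3 : proj (s b) * γ (star (s a)) = γ (star (s a)) * proj (s b) := h.proj_mem b _
    calc star (star (s b) * γ (star (s a)) * r) * (star (s b) * γ (star (s a)) * r)
        = star r * (γ (s a) * (proj (s b) * γ (star (s a)))) * r := by
          simp only [proj, star_mul, map_star, star_star, mul_assoc]
      _ = star r * γ (proj (s a)) * proj (s b) * r := by
          rw [h3, proj, proj, map_mul]
          simp only [mul_assoc]
      _ = star r * proj (s b) * r := by
          rw [hslide a b hab, mul_assoc (star r), h.proj_mul_self]
  exact ⟨hmem a b, hmem b a, hconj a b hab, hconj b a hba, (hnorm a b hab).trans hb,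
    (hnorm b a hba).trans ha⟩

end IsMultFreeDecomp

/-! ### Hypergroups from bases of a *-algebra. -/

/-- A finite linearly independent family of a *-algebra which contains the unit, is closed under
the involution, and has convex structure constants is a hypergroup. -/
theorem exists_finiteHypergroup {R : Type*} [Ring R] [StarRing R] [Algebra ℂ R] [StarModule ℂ R]
    {α : Type*} [Fintype α] [DecidableEq α] {k : α → R} (hk : LinearIndependent ℂ k)
    {coeff : α → α → α → ℝ} (hmul : ∀ a b, k a * k b = ∑ c, (coeff a b c : ℂ) • k c)
    (hnonneg : ∀ a b c, 0 ≤ coeff a b c) (hsum : ∀ a b, ∑ c, coeff a b c = 1)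
    {o : α} (ho : k o = 1) {bar : α → α} (hbar : ∀ a, bar (bar a) = a)
    (hstar : ∀ a, star (k a) = k (bar a))
    (hone : ∀ a b, coeff a b o ≠ 0 ↔ b = bar a) :
    ∃ K : FiniteHypergroup α, K.coeff = coeff ∧ K.one = o := by
  have hinj : ∀ x y : α → ℝ, ∑ c, (x c : ℂ) • k c = ∑ c, (y c : ℂ) • k c → ∀ c, x c = y c := by
    intro x y hxy c
    have h0 : ∑ c, ((x c : ℂ) - (y c : ℂ)) • k c = 0 := by
      simp only [sub_smul, Finset.sum_sub_distrib, hxy, sub_self]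
    have h1 := Fintype.linearIndependent_iff.1 hk _ h0 c
    exact_mod_cast sub_eq_zero.1 h1
  have hsingle : ∀ b, k b = ∑ c, ((if c = b then (1 : ℝ) else 0 : ℝ) : ℂ) • k c := by
    intro b
    rw [Finset.sum_eq_single b]
    · simp
    · intro c _ hc
      simp [hc]
    · simp
  have hleft : ∀ a (x : α → ℝ), k a * ∑ m, (x m : ℂ) • k m =
      ∑ l, ((∑ m, x m * coeff a m l : ℝ) : ℂ) • k l := by
    intro a x
    simp only [Finset.mul_sum, mul_smul_comm, hmul, Finset.smul_sum, smul_smul]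
    rw [Finset.sum_comm]
    refine Finset.sum_congr rfl fun l _ => ?_
    push_cast
    rw [Finset.sum_smul]
  have hright : ∀ c (x : α → ℝ), (∑ m, (x m : ℂ) • k m) * k c =
      ∑ l, ((∑ m, x m * coeff m c l : ℝ) : ℂ) • k l := by
    intro c x
    simp only [Finset.sum_mul, smul_mul_assoc, hmul, Finset.smul_sum, smul_smul]
    rw [Finset.sum_comm]
    refine Finset.sum_congr rfl fun l _ => ?_
    push_cast
    rw [Finset.sum_smul]
  refine ⟨⟨coeff, o, bar, hnonneg, hsum, ?_, ?_, ?_, hbar, ?_, hone⟩, rfl, rfl⟩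
  · intro a b c
    apply hinj
    rw [← hright c (coeff a b), ← hleft a (coeff b c), ← hmul, ← hmul, mul_assoc]
  · intro a
    apply hinj
    rw [← hmul, ho, one_mul]
    exact hsingle a
  · intro a
    apply hinj
    rw [← hmul, ho, mul_one]
    exact hsingle a
  -- The bar symmetry is the adjoint of the product formula, reindexed along `bar`; the coefficients
  -- are real.
  · intro a b
    have hbij : Function.Bijective bar := Function.Involutive.bijective hbar
    apply hinj (fun c => coeff (bar b) (bar a) (bar c))
    have h1 := congrArg star (hmul (bar b) (bar a))
    simp only [star_mul, star_sum, star_smul, hstar, hbar, Complex.star_def,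
      Complex.conj_ofReal] at h1
    rw [← hmul, h1]
    rw [← Function.Bijective.sum_comp hbij]
    simp only [hbar]

/-! ### Dimensions, the trivial component and positivity of the coefficients. -/

section Composition

variable {A B : Type*} [Ring A] [StarRing A] [Algebra ℂ A] [StarModule ℂ A]
  [Ring B] [StarRing B] [Algebra ℂ B] [StarModule ℂ B] [PositiveStar A] [PositiveStar B]
  {ι : A →⋆ₐ[ℂ] B} {κ : B →⋆ₐ[ℂ] A} {w : A} {v : B} {d : ℝ}
  {α : Type*} [Fintype α] {γ : α → B →⋆ₐ[ℂ] B} {s : α → B}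

/-- The dimension of a component of `γ` is the value of the trace on its projection. -/
theorem exists_bar_dim (h : IsConjSolution ι κ w v d) (hι : IsIrred ι)
    (hdec : IsMultFreeDecomp (can ι κ) γ s) :
    ∃ bar : α → α, (∀ a, bar (bar a) = a) ∧
      (∀ a, rotation (can ι κ) (ι w * v) (proj (s a)) = proj (s (bar a))) ∧
      (∀ a, 0 < dim (γ a)) ∧ (∀ a, dim (γ (bar a)) = dim (γ a)) ∧
      (∀ a, ι (star w) * proj (s a) * ι w = ((dim (γ a) / d : ℝ) : ℂ) • 1) ∧
      ∀ a, star (ι w * v) * proj (s a) * (ι w * v) = ((dim (γ a) : ℝ) : ℂ) • 1 := by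
  have hr := h.can_solution
  obtain ⟨bar, hbar, hrot⟩ := hdec.exists_bar hr
  choose c hc hc' using fun a => h.exists_trace hι (hdec.proj_mem a)
  have hpos : ∀ a, ∃ x : ℝ, 0 ≤ x ∧ c a = x := by
    intro a
    apply PositiveStar.exists_nonneg (proj (s a) * ι w)
    rw [← hc, star_mul, IsMultFreeDecomp.star_proj, ← map_star, mul_assoc, mul_assoc,
      ← mul_assoc (proj (s a)), hdec.proj_mul_self]
  choose x hx hcx using hpos
  have hright : ∀ a, star (ι w * v) * proj (s a) * (ι w * v) = ((d * x a : ℝ) : ℂ) • 1 := by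
    intro a
    calc star (ι w * v) * proj (s a) * (ι w * v)
        = star v * (ι (star w) * proj (s a) * ι w) * v := by
          simp only [star_mul, map_star, mul_assoc]
      _ = ((d * x a : ℝ) : ℂ) • 1 := by
          rw [hc, hcx, mul_smul_comm, mul_one, smul_mul_assoc, h.norm_right, smul_smul]
          push_cast
          rw [mul_comm]
  have hleft : ∀ a, star (ι w * v) * can ι κ (proj (s a)) * (ι w * v) =
      ((d * x a : ℝ) : ℂ) • 1 := by
    intro a
    calc star (ι w * v) * can ι κ (proj (s a)) * (ι w * v)
        = star v * ι (star w * κ (proj (s a)) * w) * v := by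
          simp only [can, StarAlgHom.comp_apply, star_mul, map_star, map_mul, mul_assoc]
      _ = ((d * x a : ℝ) : ℂ) • 1 := by
          rw [hc', hcx, map_smul, map_one, mul_smul_comm, mul_one, smul_mul_assoc, h.norm_right,
            smul_smul]
          push_cast
          rw [mul_comm]
  -- Sliding around r* converts the trace of e_{bar a} into that of γ(e_a), which agrees with that
  -- of e_a because left and right traces coincide.
  have hbarr : ∀ a, star (ι w * v) * proj (s (bar a)) * (ι w * v) = ((d * x a : ℝ) : ℂ) • 1 := by
    intro a
    rw [← hrot, star_mul_rotation hr (hdec.proj_mem a), hleft]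
  have hsol : ∀ a, IsConjSolution (γ a) (γ (bar a)) _ _ (d * x a) := fun a =>
    hdec.component_solution hr (hrot a) (by rw [hrot, hbar]) (hright a) (hbarr a)
  have hdim : ∀ a, dim (γ a) = d * x a := fun a => (hsol a).dim_eq (hdec.irred a)
  have hd := h.pos
  refine ⟨bar, hbar, hrot, fun a => ?_, fun a => ?_, fun a => ?_, fun a => ?_⟩
  · rw [hdim]
    exact (hsol a).pos
  · rw [hdim a]
    exact (hsol a).symm.dim_eq (hdec.irred _)
  · rw [hdim, mul_div_cancel_left₀ _ hd.ne', ← hcx, hc]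
  · rw [hdim, hright]

/-- The projection onto the trivial component of `γ`. -/
theorem exists_proj_eq_self (h : IsConjSolution ι κ w v d) (hι : IsIrred ι)
    (hdec : IsMultFreeDecomp (can ι κ) γ s) :
    ∃ o, proj (s o) = ((d⁻¹ : ℝ) : ℂ) • (v * star v) := by
  set p : B := ((d⁻¹ : ℝ) : ℂ) • (v * star v) with hp
  have hd := h.pos
  have hdc : ((d⁻¹ : ℝ) : ℂ) * (d : ℂ) = 1 := by
    rw [← Complex.ofReal_mul, inv_mul_cancel₀ hd.ne', Complex.ofReal_one]
  have hpmem : p ∈ Hom (can ι κ) (can ι κ) := by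
    refine (Hom _ _).smul_mem _ fun b => ?_
    change v * star v * ι (κ b) = ι (κ b) * (v * star v)
    rw [mul_assoc, h.symm.star_comm, h.symm.comm_assoc]
  have hpp : p * p = p := by
    rw [hp, smul_mul_smul_comm, mul_assoc, ← mul_assoc (star v), h.norm_right, smul_mul_assoc,
      one_mul, mul_smul_comm, smul_smul, mul_assoc, hdc, mul_one]
  have hpv : p * v = v := by
    rw [hp, smul_mul_assoc, mul_assoc, h.norm_right, mul_smul_comm, mul_one, smul_smul, hdc,
      one_smul]
  -- Compression by v lands in Hom(id_B, id_B), contained in Hom(ι, ι) = ℂ. So p is minimal, and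
  -- must equal any e_o below it.
  have hmin : ∀ a, ∃ c : ℂ, p * proj (s a) * p = c • p := by
    intro a
    have hirr : IsIrred (StarAlgHom.id ℂ B) := fun t ht => hι t (mem_Hom_comp ht ι)
    obtain ⟨c, hc⟩ := hirr _ (mul_mem_Hom (mul_mem_Hom (star_mem_Hom h.mem_right)
      (hdec.proj_mem a)) h.mem_right)
    refine ⟨c * ((d⁻¹ : ℝ) : ℂ), ?_⟩
    calc p * proj (s a) * p
        = (((d⁻¹ : ℝ) : ℂ) * ((d⁻¹ : ℝ) : ℂ)) • (v * (star v * proj (s a) * v) * star v) := by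
          rw [hp, smul_mul_assoc, smul_mul_smul_comm]
          simp only [mul_assoc]
      _ = (c * ((d⁻¹ : ℝ) : ℂ)) • p := by
          rw [hc, mul_smul_comm, mul_one, smul_mul_assoc, hp, smul_smul, smul_smul]
          congr 1
          ring
  obtain ⟨c, hc⟩ := hdec.exists_expand hpmem
  have hv : v ≠ 0 := h.symm.left_ne_zero
  obtain ⟨o, ho⟩ : ∃ o, c o ≠ 0 := by
    by_contra! h0
    apply hv
    rw [← hpv, hc]
    simp [h0]
  have ho1 : c o = 1 :=
    (hdec.coeff_of_idempotent (by rw [← hc, hpp]) o).resolve_left ho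
  obtain ⟨c', hc'⟩ := hmin o
  have h1 : proj (s o) * p = proj (s o) := by
    rw [hc, hdec.proj_mul_sum, ho1, one_smul]
  have h2 : p * proj (s o) = proj (s o) := by
    rw [hc, hdec.sum_mul_proj, ho1, one_smul]
  have h3 : proj (s o) = c' • p := by rw [← hc', h2, h1]
  have h4 : c' • p = (1 : ℂ) • p := by
    have hc0 : c' ≠ 0 := by
      rintro rfl
      exact hdec.proj_ne_zero o (by rw [h3, zero_smul])
    have h6 := hdec.proj_mul_self o
    rw [h3, smul_mul_smul_comm, hpp] at h6
    have hp0 : p ≠ 0 := by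
      intro h0
      exact hv (by rw [← hpv, h0, zero_mul])
    have h7 := smul_left_injective ℂ hp0 h6
    rw [mul_left_cancel₀ hc0 (h7.trans (mul_one c').symm)]
  exact ⟨o, by rw [h3, h4, one_smul]⟩

theorem isConvProjection_iff (h : IsConjSolution ι κ w v d) {t : A} :
    IsConvProjection ι κ w v t ↔ t ∈ Hom (dualCan ι κ) (dualCan ι κ) ∧
      fourier ι κ v t * fourier ι κ v t = fourier ι κ v t ∧
      star (fourier ι κ v t) = fourier ι κ v t := by
  refine and_congr_right fun ht => ?_
  have hm := h.fourier_mem ht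
  refine and_congr ⟨fun h1 => ?_, fun h1 => ?_⟩ ⟨fun h1 => ?_, fun h1 => ?_⟩
  · rw [dualConv] at h1
    rw [← h.fourier_fourierInv (mul_mem_Hom hm hm), h1]
  · rw [dualConv, h1, h.fourierInv_fourier ht]
  · rw [dualConvStar] at h1
    rw [← h.fourier_fourierInv (star_mem_Hom hm), h1]
  · rw [dualConvStar, h1, h.fourierInv_fourier ht]

/-- Through χ the question concerns the commutative algebra spanned by the e_a, where projections
have coefficients 0 or 1. -/
theorem isBoundaryCondition_iff (h : IsConjSolution ι κ w v d)
    (hdec : IsMultFreeDecomp (can ι κ) γ s) (t : A) :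
    IsBoundaryCondition ι κ w v t ↔ ∃ a, t = fourierInv ι κ w (proj (s a)) := by
  have hF : ∀ a, fourier ι κ v (fourierInv ι κ w (proj (s a))) = proj (s a) :=
    fun a => h.fourier_fourierInv (hdec.proj_mem a)
  have hP : ∀ a, IsConvProjection ι κ w v (fourierInv ι κ w (proj (s a))) := by
    intro a
    rw [isConvProjection_iff h, hF]
    exact ⟨h.fourierInv_mem (hdec.proj_mem a), hdec.proj_mul_self a,
      IsMultFreeDecomp.star_proj _⟩
  have hne : ∀ a, fourierInv ι κ w (proj (s a)) ≠ 0 := by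
    intro a h0
    apply hdec.proj_ne_zero a
    rw [← hF, h0]
    simp [fourier]
  constructor
  · rintro ⟨hp, h0, hmin⟩
    obtain ⟨ht, hi, -⟩ := (isConvProjection_iff h).1 hp
    obtain ⟨c, hc⟩ := hdec.exists_expand (h.fourier_mem ht)
    obtain ⟨a, ha⟩ : ∃ a, c a ≠ 0 := by
      by_contra! hc0
      apply h0
      rw [← h.fourierInv_fourier ht, hc]
      simp [hc0, fourierInv]
    have ha1 : c a = 1 := (hdec.coeff_of_idempotent (by rw [← hc, hi]) a).resolve_left ha
    refine ⟨a, (((hmin _ (hP a)) ?_).resolve_left (hne a)).symm⟩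
    rw [dualConv, hF, hc, hdec.proj_mul_sum, ha1, one_smul]
  · rintro ⟨a, rfl⟩
    refine ⟨hP a, hne a, fun p hp hpa => ?_⟩
    obtain ⟨ht, hi, -⟩ := (isConvProjection_iff h).1 hp
    obtain ⟨c, hc⟩ := hdec.exists_expand (h.fourier_mem ht)
    rw [dualConv, hF, hc, hdec.sum_mul_proj, fourierInv_smul] at hpa
    rcases hdec.coeff_of_idempotent (by rw [← hc, hi]) a with h0 | h1
    · left
      rw [← hpa, h0, zero_smul]
    · right
      rw [← hpa, h1, one_smul]

theorem linearIndependent_fourierInv (h : IsConjSolution ι κ w v d)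
    (hdec : IsMultFreeDecomp (can ι κ) γ s) :
    LinearIndependent ℂ (fun a => fourierInv ι κ w (proj (s a))) := by
  rw [Fintype.linearIndependent_iff]
  intro c hc
  refine Fintype.linearIndependent_iff.1 hdec.linearIndependent c ?_
  have h1 := congrArg (fourier ι κ v) hc
  rw [fourier_sum_smul] at h1
  simp only [h.fourier_fourierInv (hdec.proj_mem _)] at h1
  rw [h1]
  simp [fourier]

theorem conv_mem (h : IsConjSolution ι κ w v d) {s₁ s₂ : B}
    (h₁ : s₁ ∈ Hom (can ι κ) (can ι κ)) (h₂ : s₂ ∈ Hom (can ι κ) (can ι κ)) :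
    conv ι κ w v s₁ s₂ ∈ Hom (can ι κ) (can ι κ) :=
  h.fourier_mem (mul_mem_Hom (h.fourierInv_mem h₁) (h.fourierInv_mem h₂))

/-- The convolution product preserves positivity. -/
theorem exists_conv_proj (h : IsConjSolution ι κ w v d)
    (hdec : IsMultFreeDecomp (can ι κ) γ s) (a b : α) :
    ∃ c : α → ℝ, (∀ x, 0 ≤ c x) ∧
      conv ι κ w v (proj (s a)) (proj (s b)) = ∑ x, (c x : ℂ) • proj (s x) := by
  refine hdec.exists_expand_nonneg (y := ι (κ (proj (s b))) * (proj (s a) * ι w))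
    (conv_mem h (hdec.proj_mem a) (hdec.proj_mem b)) ?_
  have hcomm : proj (s a) * ι (κ (proj (s b))) = ι (κ (proj (s b))) * proj (s a) :=
    hdec.proj_mem a _
  have hidem : ι (κ (proj (s b))) * ι (κ (proj (s b))) = ι (κ (proj (s b))) := by
    rw [← map_mul, ← map_mul, hdec.proj_mul_self]
  rw [h.conv_eq (hdec.proj_mem b)]
  simp only [star_mul, ← map_star, IsMultFreeDecomp.star_proj, mul_assoc]
  rw [← mul_assoc _ _ (proj (s a) * ι w), hidem, ← mul_assoc _ (proj (s a)) (ι w), ← hcomm,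
    mul_assoc, ← mul_assoc (proj (s a)) (proj (s a)), hdec.proj_mul_self]

/-- The two square roots in h_a* and h_a combine to the ratio that rescales I_a. -/
theorem phi_eq (h : IsConjSolution ι κ w v (dim ι)) {g : B →⋆ₐ[ℂ] B} (hg : 0 < dim g) {x : B}
    (hx : x ∈ Hom g (can ι κ)) :
    phi ι w g x =
      ((dim ι / dim g : ℝ) : ℂ) • boundaryMap ι κ w v (fourierInv ι κ w (proj x)) := by
  ext m
  have hx' : star x * ι (κ m) = g m * star x := star_mem_Hom hx m
  have hsq : ((√(dim ι / dim g) : ℝ) : ℂ) * ((√(dim ι / dim g) : ℝ) : ℂ) =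
      ((dim ι / dim g : ℝ) : ℂ) := by
    rw [← Complex.ofReal_mul, Real.mul_self_sqrt (div_nonneg h.pos.le hg.le)]
  change star (hIso ι w g x) * g m * hIso ι w g x = _
  rw [LinearMap.smul_apply, h.boundaryMap_fourierInv, hIso, star_smul, smul_mul_assoc,
    smul_mul_smul_comm, Complex.star_def, Complex.conj_ofReal, hsq]
  congr 1
  simp only [proj, star_mul, star_star, ← map_star, mul_assoc]
  rw [← mul_assoc (star x) (ι (κ m)), hx', mul_assoc]

/-- The trivial coefficient of a convolution product. -/
theorem trivial_coeff (h : IsConjSolution ι κ w v d) (hdec : IsMultFreeDecomp (can ι κ) γ s)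
    [DecidableEq α] {o : α} (ho : proj (s o) = ((d⁻¹ : ℝ) : ℂ) • (v * star v))
    {bar : α → α}
    (hrot : ∀ a, rotation (can ι κ) (ι w * v) (proj (s a)) = proj (s (bar a)))
    {δ : α → ℝ} (hδ : ∀ a, star (ι w * v) * proj (s a) * (ι w * v) = (δ a : ℂ) • 1)
    {a b : α} {c : α → ℝ}
    (hc : conv ι κ w v (proj (s a)) (proj (s b)) = ∑ x, (c x : ℂ) • proj (s x)) :
    c o * d = if a = bar b then δ a else 0 := by
  have hd := h.pos
  have hov : proj (s o) * v = v := by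
    rw [ho, smul_mul_assoc, mul_assoc, h.norm_right, mul_smul_comm, mul_one, smul_smul,
      ← Complex.ofReal_mul, inv_mul_cancel₀ hd.ne', Complex.ofReal_one, one_smul]
  have e1 : star v * conv ι κ w v (proj (s a)) (proj (s b)) * v = ((c o * d : ℝ) : ℂ) • 1 := by
    -- Inserting e_o in front of the last v makes the sum collapse to its coefficient at o.
    nth_rewrite 3 [← hov]
    rw [hc, mul_assoc, ← mul_assoc _ _ v, hdec.sum_mul_proj, smul_mul_assoc, hov, mul_smul_comm,
      h.norm_right, smul_smul]
    push_cast
    rfl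
  have hcomm : proj (s a) * can ι κ (proj (s b)) = can ι κ (proj (s b)) * proj (s a) :=
    hdec.proj_mem a _
  -- Sliding γ(e_b) around r* turns it into e_{bar b}, so the value is the trace of e_a or zero, by
  -- orthogonality.
  have e2 : star v * conv ι κ w v (proj (s a)) (proj (s b)) * v =
      star (ι w * v) * (proj (s (bar b)) * proj (s a)) * (ι w * v) := by
    calc star v * conv ι κ w v (proj (s a)) (proj (s b)) * v
        = star (ι w * v) * (proj (s a) * can ι κ (proj (s b))) * (ι w * v) := by
          rw [h.conv_eq (hdec.proj_mem b)]
          simp only [can, StarAlgHom.comp_apply, star_mul, map_star, mul_assoc]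
      _ = _ := by
          rw [hcomm, ← mul_assoc (star _), ← star_mul_rotation h.can_solution (hdec.proj_mem b),
            hrot, mul_assoc (star _)]
  rw [e1, hdec.proj_mul_proj] at e2
  split_ifs at e2 ⊢ with hab
  · rw [← hab, hδ] at e2
    exact_mod_cast smul_one_inj e2
  · rw [mul_zero, zero_mul, ← zero_smul ℂ] at e2
    exact_mod_cast smul_one_inj e2

end Composition

/-! ### The representation as an algebra homomorphism, and its range. -/

section Algebra

variable {A B : Type*} [Ring A] [StarRing A] [Algebra ℂ A] [StarModule ℂ A]
  [Ring B] [StarRing B] [Algebra ℂ B] [StarModule ℂ B]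
  {ι : A →⋆ₐ[ℂ] B} {κ : B →⋆ₐ[ℂ] A} {w : A} {v : B} {d : ℝ}

/-- The map `t ↦ (m ↦ v* ι(t κ(m) w))` as a representation of `Hom(θ, θ)`. -/
def boundaryHom (h : IsConjSolution ι κ w v d) :
    EndAlg (dualCan ι κ) →ₐ[ℂ] Module.End ℂ B :=
  AlgHom.ofLinearMap (boundaryMap ι κ w v ∘ₗ (EndAlg (dualCan ι κ)).val.toLinearMap)
    h.boundaryMap_one (fun x y => h.boundaryMap_mul x y)

theorem boundaryHom_apply (h : IsConjSolution ι κ w v d) (t : EndAlg (dualCan ι κ)) :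
    boundaryHom h t = boundaryMap ι κ w v t := rfl

theorem boundaryHom_injective (h : IsConjSolution ι κ w v d) :
    Function.Injective (boundaryHom h) :=
  fun _ _ hxy => Subtype.ext (h.boundaryMap_injective hxy)

variable [PositiveStar B] {α : Type*} [Fintype α] {γ : α → B →⋆ₐ[ℂ] B} {s : α → B}

theorem range_boundaryHom (h : IsConjSolution ι κ w v d)
    (hdec : IsMultFreeDecomp (can ι κ) γ s) {c : α → ℂ} (hc : ∀ a, c a ≠ 0) :
    Set.range (boundaryHom h) = (Submodule.span ℂ (Set.range fun a =>
      c a • boundaryMap ι κ w v (fourierInv ι κ w (proj (s a)))) : Set (Module.End ℂ B)) := by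
  apply subset_antisymm
  · rintro _ ⟨t, rfl⟩
    obtain ⟨x, hx⟩ := hdec.exists_expand (h.fourier_mem t.2)
    rw [SetLike.mem_coe, boundaryHom_apply, ← h.fourierInv_fourier t.2, hx, fourierInv_sum_smul,
      map_sum]
    refine Submodule.sum_mem _ fun a _ => ?_
    rw [map_smul, ← inv_smul_smul₀ (hc a) (boundaryMap ι κ w v _)]
    exact Submodule.smul_mem _ _ (Submodule.smul_mem _ _ (Submodule.subset_span ⟨a, rfl⟩))
  · have hle : Submodule.span ℂ (Set.range fun a =>
        c a • boundaryMap ι κ w v (fourierInv ι κ w (proj (s a)))) ≤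
        LinearMap.range (boundaryHom h).toLinearMap := by
      rw [Submodule.span_le]
      rintro _ ⟨a, rfl⟩
      refine Submodule.smul_mem _ _ ⟨⟨_, h.fourierInv_mem (hdec.proj_mem a)⟩, rfl⟩
    intro x hx
    exact hle hx

end Algebra

/-! ### Assembly of the structure constants and the hypergroup. -/

section Main

variable {A B : Type*} [Ring A] [StarRing A] [Algebra ℂ A] [StarModule ℂ A]
  [Ring B] [StarRing B] [Algebra ℂ B] [StarModule ℂ B] [PositiveStar A] [PositiveStar B]

/-- The composition of boundary conditions and the hypergroup of the maps `φ a`, for an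
irreducible homomorphism with a standard solution and a multiplicity-free canonical
endomorphism. -/
theorem composition_of_boundaryConditions (ι : A →⋆ₐ[ℂ] B) (hirr : IsIrred ι) (κ : B →⋆ₐ[ℂ] A)
    (w : A) (v : B) (hwv : IsStandard ι κ w v)
    {α : Type*} [Fintype α] [DecidableEq α] (γ : α → B →⋆ₐ[ℂ] B) (s : α → B)
    (hdec : IsMultFreeDecomp (can ι κ) γ s) (d : ℝ) (hd : d = dim ι)
    (δ : α → ℝ) (hδ : ∀ a, δ a = dim (γ a)) (e : α → B) (he : ∀ a, e a = proj (s a))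
    (I : α → A) (hI : ∀ a, I a = fourierInv ι κ w (e a))
    (φ : α → Module.End ℂ B) (hφ : ∀ a, φ a = phi ι w (γ a) (s a)) :
    (∀ t, IsBoundaryCondition ι κ w v t ↔ ∃ a, t = I a) ∧
    LinearIndependent ℂ I ∧ LinearIndependent ℂ φ ∧
    0 < d ∧ (∀ a, 0 < δ a) ∧
    ∃ (C : α → α → α → ℝ) (K : FiniteHypergroup α),
      (∀ a b, I a * I b = ∑ c, (C a b c : ℂ) • I c) ∧
      (∀ a b, conv ι κ w v (e a) (e b) = ∑ c, (C a b c : ℂ) • e c) ∧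
      (∀ a b c, 0 ≤ C a b c) ∧
      φ K.one = 1 ∧
      (∀ a b, φ a * φ b = ∑ c, (K.coeff a b c : ℂ) • φ c) ∧
      (∀ a b c, K.coeff a b c = d * δ c / (δ a * δ b) * C a b c) ∧
      (∀ a b, (((d / δ a : ℝ) : ℂ) • I a) * (((d / δ b : ℝ) : ℂ) • I b) =
        ∑ c, (K.coeff a b c : ℂ) • (((d / δ c : ℝ) : ℂ) • I c)) ∧
      (∀ a b, conv ι κ w v (((d / δ a : ℝ) : ℂ) • e a) (((d / δ b : ℝ) : ℂ) • e b) =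
        ∑ c, (K.coeff a b c : ℂ) • (((d / δ c : ℝ) : ℂ) • e c)) ∧
      ∃ Φ : EndAlg (dualCan ι κ) →ₐ[ℂ] Module.End ℂ B,
        Function.Injective Φ ∧
        Set.range Φ = (Submodule.span ℂ (Set.range φ) : Set (Module.End ℂ B)) ∧
        ∀ (a : α) (t : EndAlg (dualCan ι κ)),
          (t : A) = ((d / δ a : ℝ) : ℂ) • I a → Φ t = φ a := by
  have h : IsConjSolution ι κ w v d := by rw [hd]; exact hwv
  obtain ⟨bar, hbar, hrot, hpos, hdimbar, htr, hfull⟩ := exists_bar_dim h hirr hdec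
  simp only [← hδ] at hpos hdimbar htr hfull
  have hd0 : 0 < d := h.pos
  have hr0 : ∀ a, ((d / δ a : ℝ) : ℂ) ≠ 0 := fun a => by
    exact_mod_cast (div_pos hd0 (hpos a)).ne'
  obtain rfl : e = fun a => proj (s a) := funext he
  obtain rfl : I = fun a => fourierInv ι κ w (proj (s a)) := funext hI
  have hφ' : ∀ a, φ a = ((d / δ a : ℝ) : ℂ) •
      boundaryMap ι κ w v (fourierInv ι κ w (proj (s a))) := by
    intro a
    rw [hφ, hd, hδ]
    exact phi_eq hwv (by rw [← hδ]; exact hpos a) (hdec.mem a)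
  have hIind := linearIndependent_fourierInv h hdec
  choose C hC hconv using exists_conv_proj h hdec
  have hII : ∀ a b, fourierInv ι κ w (proj (s a)) * fourierInv ι κ w (proj (s b)) =
      ∑ c, (C a b c : ℂ) • fourierInv ι κ w (proj (s c)) := by
    intro a b
    rw [← fourierInv_sum_smul, ← hconv, conv, h.fourierInv_fourier]
    exact mul_mem_Hom (h.fourierInv_mem (hdec.proj_mem a)) (h.fourierInv_mem (hdec.proj_mem b))
  have hscale : ∀ a b c, ((d / δ a : ℝ) : ℂ) * ((d / δ b : ℝ) : ℂ) * (C a b c : ℂ) =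
      ((d * δ c / (δ a * δ b) * C a b c : ℝ) : ℂ) * ((d / δ c : ℝ) : ℂ) := by
    intro a b c
    have h1 := (hpos a).ne'
    have h2 := (hpos b).ne'
    have h3 := (hpos c).ne'
    rw [← Complex.ofReal_mul, ← Complex.ofReal_mul, ← Complex.ofReal_mul]
    congr 1
    field_simp
  have hkmul : ∀ a b, (((d / δ a : ℝ) : ℂ) • fourierInv ι κ w (proj (s a))) *
      (((d / δ b : ℝ) : ℂ) • fourierInv ι κ w (proj (s b))) =
      ∑ c, ((d * δ c / (δ a * δ b) * C a b c : ℝ) : ℂ) •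
        (((d / δ c : ℝ) : ℂ) • fourierInv ι κ w (proj (s c))) := by
    intro a b
    rw [smul_mul_smul_comm, hII, Finset.smul_sum]
    simp only [smul_smul, hscale]
  have hφmul : ∀ a b, φ a * φ b =
      ∑ c, ((d * δ c / (δ a * δ b) * C a b c : ℝ) : ℂ) • φ c := by
    intro a b
    simp only [hφ', ← map_smul, ← h.boundaryMap_mul, hkmul, map_sum]
  -- The partial trace of e_a is δ_a / d, exactly the inverse of the rescaling factor.
  have hφone : ∀ a, φ a 1 = 1 := by
    intro a
    rw [hφ', LinearMap.smul_apply, h.boundaryMap_fourierInv, map_one, map_one, mul_one, htr,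
      smul_smul, ← Complex.ofReal_mul, div_mul_div_cancel₀ (hpos a).ne', div_self hd0.ne',
      Complex.ofReal_one, one_smul]
  -- Evaluate the product formula for the φ_a at 1.
  have hsum : ∀ a b, ∑ c, d * δ c / (δ a * δ b) * C a b c = 1 := by
    intro a b
    have h1 := LinearMap.congr_fun (hφmul a b) 1
    simp only [Module.End.mul_apply, hφone, LinearMap.sum_apply, LinearMap.smul_apply,
      ← Finset.sum_smul] at h1
    have h2 := smul_one_inj (B := B) ((one_smul ℂ _).trans h1)
    exact_mod_cast h2.symm
  obtain ⟨o, ho⟩ := exists_proj_eq_self h hirr hdec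
  have hδo : δ o = 1 := by
    have h1 := hfull o
    have h2 : star (ι w * v) * proj (s o) * (ι w * v) = (1 : ℂ) • 1 := by
      calc star (ι w * v) * proj (s o) * (ι w * v)
          = ((d⁻¹ : ℝ) : ℂ) • (star v * ((ι (star w) * v) * ((star v * ι w) * v))) := by
            rw [ho]
            simp only [star_mul, ← map_star, mul_smul_comm, smul_mul_assoc, mul_assoc]
        _ = (1 : ℂ) • 1 := by
            rw [h.conj_left, h.conj_star, one_mul, one_mul, h.norm_right, smul_smul,
              ← Complex.ofReal_mul, inv_mul_cancel₀ hd0.ne', Complex.ofReal_one]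
    have h3 := smul_one_inj (h1.symm.trans h2)
    exact_mod_cast h3
  have hko : ((d / δ o : ℝ) : ℂ) • fourierInv ι κ w (proj (s o)) = 1 := by
    rw [ho, fourierInv_smul, h.fourierInv_self, smul_smul, hδo, ← Complex.ofReal_mul, div_one,
      mul_inv_cancel₀ hd0.ne', Complex.ofReal_one, one_smul]
  have hkind : LinearIndependent ℂ
      (fun a => ((d / δ a : ℝ) : ℂ) • fourierInv ι κ w (proj (s a))) :=
    hIind.units_smul (fun a => Units.mk0 _ (hr0 a))
  have hkstar : ∀ a, star (((d / δ a : ℝ) : ℂ) • fourierInv ι κ w (proj (s a))) =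
      ((d / δ (bar a) : ℝ) : ℂ) • fourierInv ι κ w (proj (s (bar a))) := by
    intro a
    rw [star_smul, h.star_fourierInv (hdec.proj_mem a), IsMultFreeDecomp.star_proj, hrot, hdimbar,
      Complex.star_def, Complex.conj_ofReal]
  have hone : ∀ a b, d * δ o / (δ a * δ b) * C a b o ≠ 0 ↔ b = bar a := by
    intro a b
    have h1 := trivial_coeff h hdec ho hrot hfull (hconv a b)
    have h2 : d * δ o / (δ a * δ b) * C a b o = (C a b o * d) * (δ o / (δ a * δ b)) := by ring
    have h3 : δ o / (δ a * δ b) ≠ 0 :=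
      (div_pos (hpos o) (mul_pos (hpos a) (hpos b))).ne'
    rw [h2, h1, mul_ne_zero_iff, and_iff_left h3]
    split_ifs with hab
    · rw [hab, hbar]
      exact iff_of_true (hab ▸ (hpos a).ne') rfl
    · refine iff_of_false (by simp) fun hb => hab ?_
      rw [hb, hbar]
  -- The hypergroup axioms are checked on the rescaled I_a, where the adjoint supplies the
  -- involution, and carried over to the φ_a by the injective representation.
  obtain ⟨K, hK, hKo⟩ := exists_finiteHypergroup hkind hkmul
    (fun a b c => mul_nonneg (div_nonneg (mul_nonneg hd0.le (hpos c).le)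
      (mul_nonneg (hpos a).le (hpos b).le)) (hC a b c)) hsum hko hbar hkstar hone
  have hφfun : φ = fun a => ((d / δ a : ℝ) : ℂ) •
      boundaryMap ι κ w v (fourierInv ι κ w (proj (s a))) := funext hφ'
  refine ⟨isBoundaryCondition_iff h hdec, hIind, ?_, hd0, hpos, C, K, hII, hconv, hC, ?_, ?_, ?_,
    ?_, ?_, boundaryHom h, boundaryHom_injective h, ?_, ?_⟩
  · have h1 := hkind.map' (boundaryMap ι κ w v) (LinearMap.ker_eq_bot.2 h.boundaryMap_injective)
    have h2 : φ = boundaryMap ι κ w v ∘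
        fun a => ((d / δ a : ℝ) : ℂ) • fourierInv ι κ w (proj (s a)) := by
      ext1 a
      rw [hφ', Function.comp_apply, map_smul]
    rw [h2]
    exact h1
  · rw [hKo, hφ', ← map_smul, hko, h.boundaryMap_one]
  · rw [hK]
    exact hφmul
  · intro a b c
    rw [hK]
  · rw [hK]
    exact hkmul
  · intro a b
    have h1 : conv ι κ w v (((d / δ a : ℝ) : ℂ) • proj (s a)) (((d / δ b : ℝ) : ℂ) • proj (s b)) =
        (((d / δ a : ℝ) : ℂ) * ((d / δ b : ℝ) : ℂ)) • conv ι κ w v (proj (s a)) (proj (s b)) := by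
      simp only [conv, fourierInv_smul, smul_mul_smul_comm]
      simp only [fourier, map_smul, mul_smul_comm, smul_mul_assoc]
    rw [h1, hconv, Finset.smul_sum, hK]
    simp only [smul_smul, hscale]
  · rw [hφfun]
    exact range_boundaryHom h hdec hr0
  · intro a t ht
    rw [boundaryHom_apply, ht, map_smul, hφ']

end Main

/-! ### Positivity in a von Neumann algebra. -/

section Factors

variable {H : Type*} [NormedAddCommGroup H] [InnerProductSpace ℂ H] [CompleteSpace H]

theorem positiveStar (M : VonNeumannAlgebra H) (hM : (1 : H →L[ℂ] H) ≠ 0) :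
    PositiveStar M.toStarSubalgebra where
  exists_pair_ne := ⟨1, 0, fun h => hM (congrArg Subtype.val h)⟩
  exists_nonneg := by
    intro x c hx
    -- Pairing x*x = c with a nonzero vector gives ‖xξ‖² = c ‖ξ‖².
    obtain ⟨ξ, hξ⟩ : ∃ ξ : H, ξ ≠ 0 := by
      by_contra! h0
      exact hM (ContinuousLinearMap.ext fun ξ => by simpa using h0 ξ)
    have h1 : star (x : H →L[ℂ] H) * (x : H →L[ℂ] H) = c • 1 := congrArg Subtype.val hx
    have h2 : inner ℂ ξ ((star (x : H →L[ℂ] H) * (x : H →L[ℂ] H)) ξ) =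
        ((‖(x : H →L[ℂ] H) ξ‖ ^ 2 : ℝ) : ℂ) := by
      rw [ContinuousLinearMap.star_eq_adjoint, mul_apply_eq_comp,
        ContinuousLinearMap.adjoint_inner_right, inner_self_eq_norm_sq_to_K]
      simp
    have h3 : inner ℂ ξ ((c • (1 : H →L[ℂ] H)) ξ) = c * ((‖ξ‖ ^ 2 : ℝ) : ℂ) := by
      rw [smul_apply, one_apply_eq_self, inner_smul_right,
        inner_self_eq_norm_sq_to_K]
      simp
    rw [h1, h3] at h2
    have hn : (‖ξ‖ ^ 2 : ℝ) ≠ 0 := pow_ne_zero 2 (norm_ne_zero_iff.2 hξ)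
    refine ⟨‖(x : H →L[ℂ] H) ξ‖ ^ 2 / ‖ξ‖ ^ 2, by positivity, ?_⟩
    rw [Complex.ofReal_div, ← h2, mul_div_cancel_right₀ _ (by exact_mod_cast hn)]
  eq_zero := by
    intro x hx
    apply Subtype.ext
    have h1 : star (x : H →L[ℂ] H) * (x : H →L[ℂ] H) = 0 := congrArg Subtype.val hx
    exact CStarRing.star_mul_self_eq_zero_iff _ |>.1 h1

end Factors

end Subfactor

end

theorem mainTheorem3
    {H : Type*} [NormedAddCommGroup H] [InnerProductSpace ℂ H] [CompleteSpace H]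
    -- an irreducible type III subfactor of finite index
    (A B : VonNeumannAlgebra H) (hAB : A ≤ B)
    (hA : Subfactor.IsTypeIIIFactor A) (hB : Subfactor.IsTypeIIIFactor B)
    (ι : A.toStarSubalgebra →⋆ₐ[ℂ] B.toStarSubalgebra) (hι : ι = Subfactor.incl hAB)
    (hirr : Subfactor.IsIrred ι)
    -- a conjugate homomorphism and a standard solution of the conjugacy relations
    (κ : B.toStarSubalgebra →⋆ₐ[ℂ] A.toStarSubalgebra)
    (w : A.toStarSubalgebra) (v : B.toStarSubalgebra)
    (hwv : Subfactor.IsStandard ι κ w v)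
    -- the canonical endomorphism is multiplicity-free
    {α : Type*} [Fintype α] [DecidableEq α]
    (γ : α → B.toStarSubalgebra →⋆ₐ[ℂ] B.toStarSubalgebra) (s : α → B.toStarSubalgebra)
    (hdec : Subfactor.IsMultFreeDecomp (Subfactor.can ι κ) γ s)
    -- dimensions, projections, boundary intertwiners, positive maps
    (d : ℝ) (hd : d = Subfactor.dim ι)
    (δ : α → ℝ) (hδ : ∀ a, δ a = Subfactor.dim (γ a))
    (e : α → B.toStarSubalgebra) (he : ∀ a, e a = Subfactor.proj (s a))
    (I : α → A.toStarSubalgebra) (hI : ∀ a, I a = Subfactor.fourierInv ι κ w (e a))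
    (φ : α → Module.End ℂ B.toStarSubalgebra)
    (hφ : ∀ a, φ a = Subfactor.phi ι w (γ a) (s a)) :
    -- the `I a` are the irreducible boundary conditions, without repetition
    (∀ t, Subfactor.IsBoundaryCondition ι κ w v t ↔ ∃ a, t = I a) ∧
    LinearIndependent ℂ I ∧ LinearIndependent ℂ φ ∧
    0 < d ∧ (∀ a, 0 < δ a) ∧
    ∃ (C : α → α → α → ℝ) (K : Subfactor.FiniteHypergroup α),
      -- the composition of boundary conditions, in its two forms
      (∀ a b, I a * I b = ∑ c, (C a b c : ℂ) • I c) ∧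
      (∀ a b, Subfactor.conv ι κ w v (e a) (e b) = ∑ c, (C a b c : ℂ) • e c) ∧
      (∀ a b c, 0 ≤ C a b c) ∧
      -- the hypergroup of the maps `φ a` under composition
      φ K.one = 1 ∧
      (∀ a b, φ a * φ b = ∑ c, (K.coeff a b c : ℂ) • φ c) ∧
      -- the two coincide up to rescaling
      (∀ a b c, K.coeff a b c = d * δ c / (δ a * δ b) * C a b c) ∧
      (∀ a b, (((d / δ a : ℝ) : ℂ) • I a) * (((d / δ b : ℝ) : ℂ) • I b) =
        ∑ c, (K.coeff a b c : ℂ) • (((d / δ c : ℝ) : ℂ) • I c)) ∧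
      (∀ a b, Subfactor.conv ι κ w v (((d / δ a : ℝ) : ℂ) • e a) (((d / δ b : ℝ) : ℂ) • e b) =
        ∑ c, (K.coeff a b c : ℂ) • (((d / δ c : ℝ) : ℂ) • e c)) ∧
      -- as an isomorphism of algebras
      ∃ Φ : Subfactor.EndAlg (Subfactor.dualCan ι κ) →ₐ[ℂ] Module.End ℂ B.toStarSubalgebra,
        Function.Injective Φ ∧
        Set.range Φ = (Submodule.span ℂ (Set.range φ) : Set (Module.End ℂ B.toStarSubalgebra)) ∧
        ∀ (a : α) (t : Subfactor.EndAlg (Subfactor.dualCan ι κ)),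
          (t : A.toStarSubalgebra) = ((d / δ a : ℝ) : ℂ) • I a → Φ t = φ a := by
  have := Subfactor.positiveStar A hA.nontrivial
  have := Subfactor.positiveStar B hB.nontrivial
  exact Subfactor.composition_of_boundaryConditions ι hirr κ w v hwv γ s hdec d hd δ hδ e he
    I hI φ hφ
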